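/- Conventions. For a finite graph $G=(V,E)$ and an Abelian group $\Gamma$ of order $|E|$, a $\Gamma$-harmonious labeling of $G$ is an injection $f:V\to\Gamma$ for which the induced edge labeling $w:E\to\Gamma$, $w(xy)=f(x)+f(y)$, is a bijection. The generalized prism $Y_{m,n}$ is the Cartesian product of the path $P_m$ and the cycle $C_n$; its $n$-cycles corresponding to the first and to the last vertex of $P_m$ are called the top and the bottom cycle. The generalized closed web $CW_{m,n}$ arises from $Y_{m,n}$ by adding a new vertex and joining it by an edge to every vertex of the top cycle. The generalized open web $OW_{m,n}$ arises from $CW_{m,n}$ by removing the edges of the bottom cycle. Theorem. Let $n\ge 3$, $m\ge 2$, and let $\Gamma$ be an Abelian group of order $(2m-1)n$. Suppose that $\Gamma$ has a subgroup $H$ of order $n$ such that the quotient group $\Gamma/H$ is cyclic and such that 1. $n$ is odd, or 2. $n$ is even and $H$ has a subgroup isomorphic to $\mathbb{Z}_2\oplus\mathbb{Z}_{2s}$ for some $s\ge 2$. Then $OW_{m,n}$ admits a $\Gamma$-harmonious labeling. -/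

import Mathlib

namespace GammaHarmonious

/-- The edge label induced by a vertex labelling `f`: the edge `xy` gets `f x + f y`. -/
def edgeLabel {V Γ : Type*} [AddCommGroup Γ] (f : V → Γ) : Sym2 V → Γ :=
  Sym2.lift ⟨fun x y => f x + f y, fun x y => add_comm (f x) (f y)⟩

/-- `f` is a `Γ`-harmonious labelling of `G`: it is injective on the vertices and the induced
edge labelling is a bijection from the edge set of `G` onto `Γ`. -/
def IsHarmoniousLabeling {V Γ : Type*} [AddCommGroup Γ] (G : SimpleGraph V) (f : V → Γ) : Prop :=
  Function.Injective f ∧ Function.Bijective (fun e : G.edgeSet => edgeLabel f (e : Sym2 V))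

/-- `G` is `Γ`-harmonious. -/
def IsHarmonious {V : Type*} (G : SimpleGraph V) (Γ : Type*) [AddCommGroup Γ] : Prop :=
  ∃ f : V → Γ, IsHarmoniousLabeling G f

/-- The generalized prism `Y_{m,n}`, the Cartesian product of the path `P_m` and the cycle `C_n`.
The top cycle is the one with first coordinate `0`, the bottom cycle the one with first
coordinate `m - 1`. -/
def generalizedPrism (m n : ℕ) : SimpleGraph (Fin m × Fin n) :=
  (SimpleGraph.pathGraph m).boxProd (SimpleGraph.cycleGraph n)

/-- The generalized closed web `CW_{m,n}`: the generalized prism together with a new vertex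
`none`, joined to every vertex of the top cycle. -/
def generalizedClosedWeb (m n : ℕ) : SimpleGraph (Option (Fin m × Fin n)) where
  Adj
    | none, none => False
    | none, some y => (y.1 : ℕ) = 0
    | some x, none => (x.1 : ℕ) = 0
    | some x, some y => (generalizedPrism m n).Adj x y
  symm := ⟨by
    rintro (_ | x) (_ | y) h
    · exact h
    · exact h
    · exact h
    · exact SimpleGraph.Adj.symm (G := generalizedPrism m n) h⟩
  loopless := ⟨by
    rintro (_ | x) h
    · exact h
    · exact SimpleGraph.irrefl (generalizedPrism m n) h⟩

/-- The edges of the bottom cycle, as edges of the closed web: those with both end vertices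
`(i, a)`, `(i, b)` on the level `i = m - 1`, where `a` and `b` are adjacent in `C_n`. -/
def bottomCycleEdges (m n : ℕ) : Set (Sym2 (Option (Fin m × Fin n))) :=
  {e | ∃ (i : Fin m) (a b : Fin n), (i : ℕ) + 1 = m ∧ (SimpleGraph.cycleGraph n).Adj a b ∧
    e = s(some (i, a), some (i, b))}

/-- The generalized open web `OW_{m,n}`: the generalized closed web without the edges of the
bottom cycle. -/
def generalizedOpenWeb (m n : ℕ) : SimpleGraph (Option (Fin m × Fin n)) :=
  (generalizedClosedWeb m n).deleteEdges (bottomCycleEdges m n)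

/-- The condition on an abelian group `H` of order `n`: either `n` is odd, or `n` is even and
`H` has a subgroup isomorphic to `Z_2 ⊕ Z_{2s}` for some `s ≥ 2`. -/
def CycleCondition (n : ℕ) (H : Type*) [AddCommGroup H] : Prop :=
  Nat.card H = n ∧
    (Odd n ∨
      (Even n ∧ ∃ s : ℕ, 2 ≤ s ∧ ∃ L : AddSubgroup H, Nonempty (L ≃+ ZMod 2 × ZMod (2 * s))))

end GammaHarmonious

namespace GammaHarmonious

/-! Let `n = |H|`, `m = l + 1`, and let `t` generate `Γ/H`, which has odd order `2l + 1`. If `H` has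
a cyclic listing `h` with pairwise distinct neighbour sums, label the added vertex `2l t` and the
vertex `(i, j)` by `i t + h(i + j)`. The `i`-th cycle then has its edge labels in the coset `2i t +
H`, the paths from level `i` to `i + 1` in `(2i + 1) t + H`, and the spokes in `2l t + H`. Because
of the shift `i + j`, path edges also carry sums of neighbours in the listing, so every coset is
filled exactly once (`isHarmoniousLabeling_openWebLabel`). It remains to show that `H` is cyclically
harmonious.

There are two obstructions. The sum of all edge sums is twice the sum of all elements, so the
elements must sum to zero, which excludes a unique involution; and a nontrivial elementary abelian
2-group never produces the edge sum `0`. `RichTwoTorsion` excludes both for even order, and the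
proof shows that it suffices.

The main tool is lifting (`cyclicallyHarmonious_of_quotient`): traverse a harmonious cycle of `G/K`
`|K|` times. Cosets separate the columns of the resulting array, so each column and each column of
sums only has to run through `K` without repetition. An element of odd order gives a suitable `K` by
doubling, which settles odd order by induction. For even order, `K` is `(ℤ/2)⁴` or `ℤ/2 × ℤ/4`, with
explicit tables alternating along the columns.

For even order, the induction needs a rich quotient. Let `T` be the 2-torsion. If `|T| > 32`, a
subgroup `(ℤ/2)⁴` of `T` can be removed. If an odd prime divides the order, an element of that order
can be removed unless the doubles form the cyclic group it generates; the remaining groups `T × ℤ/p`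
have explicit listings. In a 2-group with noncyclic doubles, a well-chosen `ℤ/2 × ℤ/4` is removed.
When the doubles are cyclic, or removal leaves a cyclic quotient, that quotient may be cyclic of
even order and hence not harmonious; then each coset is visited twice per round
(`HalfListing.cyclicallyHarmonious`). -/

/-- A finite abelian group is cyclically harmonious if its elements can be listed in a cyclic order
in which the sums of neighbours are pairwise distinct. -/
def CyclicallyHarmonious (G : Type*) [AddCommGroup G] : Prop :=
  ∃ h : ℕ → G, (∀ i < Nat.card G, ∀ j < Nat.card G, h i = h j → i = j) ∧
    ∀ i < Nat.card G, ∀ j < Nat.card G,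
      h i + h ((i + 1) % Nat.card G) = h j + h ((j + 1) % Nat.card G) → i = j

/-! ### Listings as arrays, and lifting from a quotient -/

/-- The successor of the `i`-th entry of row `a` when an array with rows of length `l` is read row
by row and cyclically. -/
def next {G : Type*} (l r : ℕ) (v : ℕ → ℕ → G) (i a : ℕ) : G :=
  if i + 1 < l then v (i + 1) a else v 0 ((a + 1) % r)

theorem eq_next {G : Type*} {l r : ℕ} (v : ℕ → ℕ → G) {j : ℕ} (hj : j < l * r) :
    v ((j + 1) % (l * r) % l) ((j + 1) % (l * r) / l) = next l r v (j % l) (j / l) := by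
  have hl : 0 < l := Nat.pos_of_ne_zero (by rintro rfl; simp at hj)
  have ha : j / l < r := Nat.div_lt_of_lt_mul hj
  have hi : j % l < l := Nat.mod_lt _ hl
  have hja : l * (j / l) + j % l = j := Nat.div_add_mod j l
  generalize j / l = a at *
  generalize j % l = i at *
  subst hja
  unfold next
  split_ifs with h
  · have h2 : l * a + i + 1 < l * r := by nlinarith
    rw [Nat.mod_eq_of_lt h2, add_assoc, Nat.mul_add_mod, Nat.mod_eq_of_lt h,
      Nat.mul_add_div hl, Nat.div_eq_of_lt h, add_zero]
  · have h3 : i + 1 = l := by omega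
    have h2 : l * a + i + 1 = l * (a + 1) := by rw [add_assoc, h3]; ring
    rw [h2, Nat.mul_mod_mul_left, Nat.mul_mod_right, Nat.mul_div_cancel_left _ hl]

theorem cyclicallyHarmonious_of_array {G : Type*} [AddCommGroup G] (l r : ℕ) (v : ℕ → ℕ → G)
    (hc : Nat.card G = l * r)
    (hv : ∀ i < l, ∀ a < r, ∀ i' < l, ∀ a' < r, v i a = v i' a' → i = i' ∧ a = a')
    (hs : ∀ i < l, ∀ a < r, ∀ i' < l, ∀ a' < r,
      v i a + next l r v i a = v i' a' + next l r v i' a' → i = i' ∧ a = a') :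
    CyclicallyHarmonious G := by
  have key : ∀ j < l * r, j % l < l ∧ j / l < r := fun j hj =>
    ⟨Nat.mod_lt _ (Nat.pos_of_ne_zero (by rintro rfl; simp at hj)), Nat.div_lt_of_lt_mul hj⟩
  have fin : ∀ i j, i % l = j % l ∧ i / l = j / l → i = j := by
    rintro i j ⟨h1, h2⟩
    rw [← Nat.div_add_mod i l, ← Nat.div_add_mod j l, h1, h2]
  refine ⟨fun j => v (j % l) (j / l), ?_, ?_⟩
  · rw [hc]
    intro i hi j hj h
    exact fin i j (hv _ (key i hi).1 _ (key i hi).2 _ (key j hj).1 _ (key j hj).2 h)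
  · rw [hc]
    intro i hi j hj h
    simp only [eq_next v hi, eq_next v hj] at h
    exact fin i j (hs _ (key i hi).1 _ (key i hi).2 _ (key j hj).1 _ (key j hj).2 h)

/-- Column `i` lies in the coset `q i`, and the sums starting in column `i` lie in the coset `q i +
q (i + 1)`. Harmony of the quotient therefore separates different columns. Within one column the
coset representatives cancel, so only the corrections `u` in `K` matter. -/
theorem cyclicallyHarmonious_of_quotient {G : Type*} [AddCommGroup G]
    (K : AddSubgroup G) (hQ : CyclicallyHarmonious (G ⧸ K)) (u : ℕ → ℕ → G)
    (huK : ∀ i a, u i a ∈ K)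
    (hu : ∀ i < Nat.card (G ⧸ K), ∀ a < Nat.card K, ∀ b < Nat.card K, u i a = u i b → a = b)
    (hs : ∀ i < Nat.card (G ⧸ K), ∀ a < Nat.card K, ∀ b < Nat.card K,
      u i a + next (Nat.card (G ⧸ K)) (Nat.card K) u i a =
        u i b + next (Nat.card (G ⧸ K)) (Nat.card K) u i b → a = b) :
    CyclicallyHarmonious G := by
  obtain ⟨q, hq, hqs⟩ := hQ
  set k := Nat.card (G ⧸ K) with hk
  set r := Nat.card K with hr
  have hmk : ∀ i a, ((Quotient.out (q i) + u i a : G) : G ⧸ K) = q i := by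
    intro i a
    rw [QuotientAddGroup.mk_add, (QuotientAddGroup.eq_zero_iff _).2 (huK i a), add_zero]
    exact Quotient.out_eq' _
  set v : ℕ → ℕ → G := fun i a => Quotient.out (q i) + u i a with hvdef
  have hnext : ∀ i < k, ∀ a,
      next k r v i a = Quotient.out (q ((i + 1) % k)) + next k r u i a := by
    intro i hi a
    unfold next
    split_ifs with h
    · rw [Nat.mod_eq_of_lt h]
    · have : i + 1 = k := by omega
      rw [this, Nat.mod_self]
  have hmkn : ∀ i < k, ∀ a, ((next k r v i a : G) : G ⧸ K) = q ((i + 1) % k) := by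
    intro i hi a
    unfold next
    split_ifs with h
    · rw [Nat.mod_eq_of_lt h]; exact hmk _ _
    · have : i + 1 = k := by omega
      rw [this, Nat.mod_self]; exact hmk _ _
  refine cyclicallyHarmonious_of_array k r v (AddSubgroup.card_eq_card_quotient_mul_card_addSubgroup K) ?_ ?_
  · intro i hi a ha i' hi' a' ha' h
    have h1 : q i = q i' := by
      rw [← hmk i a, ← hmk i' a']; exact congrArg _ h
    obtain rfl := hq i hi i' hi' h1
    exact ⟨rfl, hu i hi a ha a' ha' (add_left_cancel h)⟩
  · intro i hi a ha i' hi' a' ha' h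
    have h1 : q i + q ((i + 1) % k) = q i' + q ((i' + 1) % k) := by
      rw [← hmk i a, ← hmk i' a', ← hmkn i hi a, ← hmkn i' hi' a', ← QuotientAddGroup.mk_add,
        ← QuotientAddGroup.mk_add]
      exact congrArg _ h
    obtain rfl := hqs i hi i' hi' h1
    refine ⟨rfl, hs i hi a ha a' ha' ?_⟩
    rw [hnext i hi, hnext i hi] at h
    have h2 : ∀ x y z w : G, x + y + (z + w) = x + z + (y + w) := fun x y z w => by abel
    simp only [hvdef] at h
    rw [h2, h2 _ (u i a')] at h
    exact add_left_cancel h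

/-- Doubling and consecutive sums are injective modulo an odd number. -/
theorem cyclicallyHarmonious_of_odd_element {G : Type*} [AddCommGroup G] (g : G)
    (hg : Odd (addOrderOf g)) (hQ : CyclicallyHarmonious (G ⧸ AddSubgroup.zmultiples g)) :
    CyclicallyHarmonious G := by
  have hr : Nat.card (AddSubgroup.zmultiples g) = addOrderOf g := Nat.card_zmultiples g
  obtain ⟨s, hs⟩ := hg
  have inj : ∀ x y : ℕ, x • g = y • g → x ≡ y [MOD addOrderOf g] := fun x y h =>
    nsmul_eq_nsmul_iff_modEq.1 h
  have inj2 : ∀ a < addOrderOf g, ∀ b < addOrderOf g, (2 * a) • g = (2 * b) • g → a = b := by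
    intro a ha b hb h
    have h1 := inj _ _ h
    have h2 : a ≡ b [MOD addOrderOf g] := by
      refine Nat.ModEq.cancel_left_of_coprime ?_ h1
      rw [hs]; simp
    rwa [Nat.ModEq, Nat.mod_eq_of_lt ha, Nat.mod_eq_of_lt hb] at h2
  have hmod : ∀ a : ℕ, (a % addOrderOf g) • g = a • g := fun a => mod_addOrderOf_nsmul g a
  refine cyclicallyHarmonious_of_quotient _ hQ (fun _ a => a • g)
    (fun _ a => AddSubgroup.nsmul_mem_zmultiples g a) ?_ ?_
  · intro i _ a ha b hb h
    rw [hr] at ha hb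
    refine inj2 a ha b hb ?_
    rw [mul_nsmul', mul_nsmul']
    exact congrArg _ h
  · intro i _ a ha b hb h
    rw [hr] at ha hb h
    unfold next at h
    split_ifs at h
    · refine inj2 a ha b hb ?_
      simpa [two_mul, add_nsmul] using h
    -- At the end of a row the sum is `a + (a + 1)`; the constant cancels and doubling remains.
    · refine inj2 a ha b hb ?_
      simp only [hmod, add_nsmul, ← add_assoc, one_nsmul] at h
      simpa [two_mul, add_nsmul] using h

/-! ### Addition tables and column patterns over a subgroup -/

/-- An addition table on `{0, …, n - 1}` with neutral element `0` that is closed and has inverses. -/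
structure IsTable (n : ℕ) (op : ℕ → ℕ → ℕ) : Prop where
  pos : 0 < n
  closed : ∀ a < n, ∀ b < n, op a b < n
  inv : ∀ a < n, ∃ b < n, op a b = 0

/-- `c` identifies the addition table `op` on `{0, …, n - 1}` with a part of the group `G`. -/
structure IsCoding {G : Type*} [AddCommGroup G] (n : ℕ) (op : ℕ → ℕ → ℕ) (c : ℕ → G) : Prop where
  zero : c 0 = 0
  add : ∀ a < n, ∀ b < n, c a + c b = c (op a b)
  inj : ∀ a < n, ∀ b < n, c a = c b → a = b

/-- The subgroup that is identified with an addition table. -/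
def codedSubgroup {G : Type*} [AddCommGroup G] {n : ℕ} {op : ℕ → ℕ → ℕ} {c : ℕ → G}
    (ht : IsTable n op) (hc : IsCoding n op c) : AddSubgroup G where
  carrier := {x | ∃ a < n, c a = x}
  add_mem' := by
    rintro _ _ ⟨a, ha, rfl⟩ ⟨b, hb, rfl⟩
    exact ⟨op a b, ht.closed a ha b hb, (hc.add a ha b hb).symm⟩
  zero_mem' := ⟨0, ht.pos, hc.zero⟩
  neg_mem' := by
    rintro _ ⟨a, ha, rfl⟩
    obtain ⟨b, hb, h⟩ := ht.inv a ha
    exact ⟨b, hb, eq_neg_of_add_eq_zero_right (by rw [hc.add a ha b hb, h, hc.zero])⟩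

theorem card_codedSubgroup {G : Type*} [AddCommGroup G] {n : ℕ} {op : ℕ → ℕ → ℕ} {c : ℕ → G}
    (ht : IsTable n op) (hc : IsCoding n op c) : Nat.card (codedSubgroup ht hc) = n := by
  have e : Fin n ≃ codedSubgroup ht hc :=
    Equiv.ofBijective (fun a => ⟨c a, a, a.2, rfl⟩) ⟨fun a b h =>
      Fin.ext (hc.inj a a.2 b b.2 (congrArg Subtype.val h)), fun ⟨_, a, ha, h⟩ =>
      ⟨⟨a, ha⟩, Subtype.ext h⟩⟩
  rw [← Nat.card_congr e, Nat.card_fin]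

/-- Injectivity of the pointwise sum of two tables. -/
theorem IsCoding.add_eq {G : Type*} [AddCommGroup G] {n : ℕ} {op : ℕ → ℕ → ℕ} {c : ℕ → G}
    (ht : IsTable n op) (hc : IsCoding n op c) {a b a' b' : ℕ} (ha : a < n) (hb : b < n)
    (ha' : a' < n) (hb' : b' < n) (h : c a + c b = c a' + c b') : op a b = op a' b' := by
  rw [hc.add a ha b hb, hc.add a' ha' b' hb'] at h
  exact hc.inj _ (ht.closed a ha b hb) _ (ht.closed a' ha' b' hb') h

/-- Two listings `A` and `B` of an addition table such that `A a + B a` and `B a + A (a + 1)` are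
listings as well. -/
structure EvenListing (n : ℕ) (op : ℕ → ℕ → ℕ) (A B : ℕ → ℕ) : Prop where
  ltA : ∀ a < n, A a < n
  ltB : ∀ a < n, B a < n
  injA : ∀ a < n, ∀ b < n, A a = A b → a = b
  injB : ∀ a < n, ∀ b < n, B a = B b → a = b
  injAB : ∀ a < n, ∀ b < n, op (A a) (B a) = op (A b) (B b) → a = b
  injBA : ∀ a < n, ∀ b < n, op (B a) (A ((a + 1) % n)) = op (B b) (A ((b + 1) % n)) → a = b

/-- Three listings `A`, `B`, `C` of an addition table such that `A a + B a`, `B a + C a` and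
`C a + A (a + 1)` are listings as well. -/
structure OddListing (n : ℕ) (op : ℕ → ℕ → ℕ) (A B C : ℕ → ℕ) : Prop where
  ltA : ∀ a < n, A a < n
  ltB : ∀ a < n, B a < n
  ltC : ∀ a < n, C a < n
  injA : ∀ a < n, ∀ b < n, A a = A b → a = b
  injB : ∀ a < n, ∀ b < n, B a = B b → a = b
  injC : ∀ a < n, ∀ b < n, C a = C b → a = b
  injAB : ∀ a < n, ∀ b < n, op (A a) (B a) = op (A b) (B b) → a = b
  injBC : ∀ a < n, ∀ b < n, op (B a) (C a) = op (B b) (C b) → a = b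
  injCA : ∀ a < n, ∀ b < n, op (C a) (A ((a + 1) % n)) = op (C b) (A ((b + 1) % n)) → a = b

/-- The columns alternate `A`, `B`, `A`, `B`, …. As their number is even, the last one is `B`, and
only the passage to the next row meets the shifted sum `B a + A (a + 1)`. -/
theorem EvenListing.cyclicallyHarmonious {G : Type*} [AddCommGroup G] {n : ℕ}
    {op : ℕ → ℕ → ℕ} {c : ℕ → G} {A B : ℕ → ℕ} (hAB : EvenListing n op A B)
    (ht : IsTable n op) (hc : IsCoding n op c)
    (hQ : CyclicallyHarmonious (G ⧸ codedSubgroup ht hc))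
    (hk : Even (Nat.card (G ⧸ codedSubgroup ht hc))) : CyclicallyHarmonious G := by
  have lt1 : ∀ a, (a + 1) % n < n := fun a => Nat.mod_lt _ ht.pos
  have modA : ∀ a, A (a % n) < n := fun a => hAB.ltA _ (Nat.mod_lt _ ht.pos)
  have modB : ∀ a, B (a % n) < n := fun a => hAB.ltB _ (Nat.mod_lt _ ht.pos)
  refine cyclicallyHarmonious_of_quotient _ hQ
    (fun i a => c (if i % 2 = 0 then A (a % n) else B (a % n))) ?_ ?_ ?_
  · intro i a
    refine ⟨_, ?_, rfl⟩
    split_ifs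
    exacts [modA a, modB a]
  · intro i _ a ha b hb h
    rw [card_codedSubgroup] at ha hb
    rw [Nat.mod_eq_of_lt ha, Nat.mod_eq_of_lt hb] at h
    split_ifs at h
    · exact hAB.injA a ha b hb (hc.inj _ (hAB.ltA a ha) _ (hAB.ltA b hb) h)
    · exact hAB.injB a ha b hb (hc.inj _ (hAB.ltB a ha) _ (hAB.ltB b hb) h)
  · intro i hi a ha b hb h
    simp only [card_codedSubgroup] at ha hb h
    obtain ⟨k, hk⟩ := hk
    unfold next at h
    simp only [Nat.mod_eq_of_lt ha, Nat.mod_eq_of_lt hb, Nat.mod_mod] at h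
    rcases Nat.mod_two_eq_zero_or_one i with h0 | h1
    · simp only [if_pos h0, if_pos (show i + 1 < Nat.card (G ⧸ codedSubgroup ht hc) by omega),
        if_neg (show ¬ (i + 1) % 2 = 0 by omega)] at h
      exact hAB.injAB a ha b hb (hc.add_eq ht (hAB.ltA a ha) (hAB.ltB a ha) (hAB.ltA b hb)
        (hAB.ltB b hb) h)
    · have h1' : ¬ i % 2 = 0 := by omega
      by_cases h2 : i + 1 < Nat.card (G ⧸ codedSubgroup ht hc)
      · simp only [if_pos h2, if_neg h1', if_pos (show (i + 1) % 2 = 0 by omega)] at h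
        refine hAB.injAB a ha b hb (hc.add_eq ht (hAB.ltA a ha) (hAB.ltB a ha) (hAB.ltA b hb)
          (hAB.ltB b hb) ?_)
        rwa [add_comm, add_comm (c (A b))]
      · simp only [if_neg h2, if_neg h1', if_true] at h
        exact hAB.injBA a ha b hb (hc.add_eq ht (hAB.ltB a ha) (hAB.ltA _ (lt1 a)) (hAB.ltB b hb)
          (hAB.ltA _ (lt1 b)) h)

/-- The columns are `A`, `B`, …, `A`, `B`, `C`: a third listing closes a row of odd length, and the
shift occurs at the passage from `C` to `A`. -/
theorem OddListing.cyclicallyHarmonious {G : Type*} [AddCommGroup G] {n : ℕ}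
    {op : ℕ → ℕ → ℕ} {c : ℕ → G} {A B C : ℕ → ℕ} (hABC : OddListing n op A B C)
    (ht : IsTable n op) (hc : IsCoding n op c)
    (hQ : CyclicallyHarmonious (G ⧸ codedSubgroup ht hc))
    (hk : Odd (Nat.card (G ⧸ codedSubgroup ht hc)))
    (hk1 : 1 < Nat.card (G ⧸ codedSubgroup ht hc)) : CyclicallyHarmonious G := by
  have lt1 : ∀ a, (a + 1) % n < n := fun a => Nat.mod_lt _ ht.pos
  have modA : ∀ a, A (a % n) < n := fun a => hABC.ltA _ (Nat.mod_lt _ ht.pos)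
  have modB : ∀ a, B (a % n) < n := fun a => hABC.ltB _ (Nat.mod_lt _ ht.pos)
  have modC : ∀ a, C (a % n) < n := fun a => hABC.ltC _ (Nat.mod_lt _ ht.pos)
  refine cyclicallyHarmonious_of_quotient _ hQ
    (fun i a => c (if i + 1 = Nat.card (G ⧸ codedSubgroup ht hc) then C (a % n) else
      if i % 2 = 0 then A (a % n) else B (a % n))) ?_ ?_ ?_
  · intro i a
    refine ⟨_, ?_, rfl⟩
    split_ifs
    exacts [modC a, modA a, modB a]
  · intro i _ a ha b hb h
    rw [card_codedSubgroup] at ha hb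
    rw [Nat.mod_eq_of_lt ha, Nat.mod_eq_of_lt hb] at h
    split_ifs at h
    · exact hABC.injC a ha b hb (hc.inj _ (hABC.ltC a ha) _ (hABC.ltC b hb) h)
    · exact hABC.injA a ha b hb (hc.inj _ (hABC.ltA a ha) _ (hABC.ltA b hb) h)
    · exact hABC.injB a ha b hb (hc.inj _ (hABC.ltB a ha) _ (hABC.ltB b hb) h)
  · intro i hi a ha b hb h
    simp only [card_codedSubgroup] at ha hb h
    obtain ⟨k, hk⟩ := hk
    unfold next at h
    simp only [Nat.mod_eq_of_lt ha, Nat.mod_eq_of_lt hb, Nat.mod_mod] at h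
    by_cases h2 : i + 1 < Nat.card (G ⧸ codedSubgroup ht hc)
    · have h3 : ¬ i + 1 = Nat.card (G ⧸ codedSubgroup ht hc) := by omega
      simp only [if_pos h2, if_neg h3] at h
      rcases Nat.mod_two_eq_zero_or_one i with h0 | h1
      · rw [if_pos h0, if_pos h0, if_neg (by omega), if_neg (by omega), if_neg (by omega),
          if_neg (by omega)] at h
        exact hABC.injAB a ha b hb (hc.add_eq ht (hABC.ltA a ha) (hABC.ltB a ha) (hABC.ltA b hb)
          (hABC.ltB b hb) h)
      · have h1' : ¬ i % 2 = 0 := by omega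
        simp only [if_neg h1', show (i + 1) % 2 = 0 by omega, if_true] at h
        split_ifs at h
        · exact hABC.injBC a ha b hb (hc.add_eq ht (hABC.ltB a ha) (hABC.ltC a ha) (hABC.ltB b hb)
            (hABC.ltC b hb) h)
        · refine hABC.injAB a ha b hb (hc.add_eq ht (hABC.ltA a ha) (hABC.ltB a ha)
            (hABC.ltA b hb) (hABC.ltB b hb) ?_)
          rwa [add_comm, add_comm (c (A b))]
    · have h3 : i + 1 = Nat.card (G ⧸ codedSubgroup ht hc) := by omega
      -- More than one column is needed here, so that column `0` is an `A` column rather than the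
      -- final `C` column.
      have h4 : ¬ 0 + 1 = Nat.card (G ⧸ codedSubgroup ht hc) := by omega
      simp only [if_neg h2, if_pos h3, if_neg h4, if_true] at h
      exact hABC.injCA a ha b hb (hc.add_eq ht (hABC.ltC a ha) (hABC.ltA _ (lt1 a)) (hABC.ltC b hb)
        (hABC.ltA _ (lt1 b)) h)

/-- Four half listings `p`, `q`, `p'`, `q'` of an addition table, in which `p`, `q` and `p'`, `q'`
complement each other, and so do the sums `p + q` and `p' + q' + d` and the sums `q + p'` and
`q' + p (· + 1)`. -/
structure HalfListing (r : ℕ) (op : ℕ → ℕ → ℕ) (d : ℕ) (p q p' q' : ℕ → ℕ) : Prop where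
  ltp : ∀ a < r, p a < 2 * r
  ltq : ∀ a < r, q a < 2 * r
  ltp' : ∀ a < r, p' a < 2 * r
  ltq' : ∀ a < r, q' a < 2 * r
  injp : ∀ a < r, ∀ b < r, p a = p b → a = b
  injq : ∀ a < r, ∀ b < r, q a = q b → a = b
  injp' : ∀ a < r, ∀ b < r, p' a = p' b → a = b
  injq' : ∀ a < r, ∀ b < r, q' a = q' b → a = b
  ne : ∀ a < r, ∀ b < r, p a ≠ q b
  ne' : ∀ a < r, ∀ b < r, p' a ≠ q' b
  injpq : ∀ a < r, ∀ b < r, op (p a) (q a) = op (p b) (q b) → a = b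
  injpq' : ∀ a < r, ∀ b < r, op (p' a) (q' a) = op (p' b) (q' b) → a = b
  nepq : ∀ a < r, ∀ b < r, op (p a) (q a) ≠ op (op (p' b) (q' b)) d
  injqp : ∀ a < r, ∀ b < r, op (q a) (p' a) = op (q b) (p' b) → a = b
  injqp' : ∀ a < r, ∀ b < r,
    op (q' a) (p ((a + 1) % r)) = op (q' b) (p ((b + 1) % r)) → a = b
  neqp : ∀ a < r, ∀ b < r, op (q a) (p' a) ≠ op (q' b) (p ((b + 1) % r))

/-- The quotient is cyclic of even order `k`, hence not harmonious. A row visits the cosets `0, 0,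
1, 1, …, k - 1, k - 1`, so each coset, both of elements and of sums, is met twice per row. With `r =
|K|/2` rows, the two visits must fill complementary halves of the coset. -/
theorem HalfListing.cyclicallyHarmonious {G : Type*} [AddCommGroup G] {r k d : ℕ}
    {op : ℕ → ℕ → ℕ} {c : ℕ → G} {p q p' q' : ℕ → ℕ} (H : HalfListing r op d p q p' q')
    (ht : IsTable (2 * r) op) (hc : IsCoding (2 * r) op c) (hd : d < 2 * r) (t : G)
    (hk : Even k) (hk0 : 0 < k) (hkt : k • t = c d)
    (hmem : ∀ m : ℕ, m • t ∈ codedSubgroup ht hc → k ∣ m)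
    (hcard : Nat.card G = 2 * r * k) : CyclicallyHarmonious G := by
  have hr : 0 < r := by have := ht.pos; omega
  set K := codedSubgroup ht hc
  have hcK : ∀ a < 2 * r, c a ∈ K := fun a ha => ⟨a, ha, rfl⟩
  have cls : ∀ m m' : ℕ, m < k → m' < k → ∀ x ∈ K, ∀ x' ∈ K,
      m • t + x = m' • t + x' → m = m' ∧ x = x' := by
    have main : ∀ m m' : ℕ, m ≤ m' → m' < k → ∀ x ∈ K, ∀ x' ∈ K,
        m • t + x = m' • t + x' → m = m' ∧ x = x' := by
      intro m m' hle hm' x hx x' hx' h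
      obtain ⟨e, rfl⟩ := Nat.exists_eq_add_of_le hle
      rw [add_nsmul, add_assoc] at h
      have h1 : x = e • t + x' := add_left_cancel h
      have h2 : e • t ∈ K := by
        rw [show e • t = x - x' by rw [h1, add_sub_cancel_right]]
        exact K.sub_mem hx hx'
      have h3 : e = 0 := Nat.eq_zero_of_dvd_of_lt (hmem e h2) (by omega)
      subst h3
      exact ⟨rfl, by simpa using h1⟩
    intro m m' hm hm' x hx x' hx' h
    rcases le_total m m' with hle | hle
    · exact main m m' hle hm' x hx x' hx' h
    · obtain ⟨h1, h2⟩ := main m' m hle hm x' hx' x hx h.symm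
      exact ⟨h1.symm, h2.symm⟩
  -- Column `m` lies over `m / 2`. Since `m / 2 + (m + 1) / 2 = m`, its sum with the next column
  -- lies over `m`, so columns `m` and `k + m` share a coset of sums. The first `k` columns use `p`,
  -- `q`, the others `p'`, `q'`.
  set v : ℕ → ℕ → G := fun m a => (m / 2) • t +
    c (if m < k then (if m % 2 = 0 then p a else q a) else (if m % 2 = 0 then p' a else q' a))
    with hv
  obtain ⟨s, rfl⟩ := hk
  have lt1 : ∀ a, (a + 1) % r < r := fun a => Nat.mod_lt _ hr
  have sum1 : ∀ m a, m + 1 < s + s →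
      v m a + next (2 * (s + s)) r v m a = m • t + (c (p a) + c (q a)) := by
    intro m a hm
    simp only [hv, next, if_pos (show m + 1 < 2 * (s + s) by omega), if_pos hm,
      if_pos (show m < s + s by omega)]
    have h1 : m / 2 + (m + 1) / 2 = m := by omega
    have h2 : m • t = (m / 2) • t + ((m + 1) / 2) • t := by rw [← add_nsmul, h1]
    rw [h2]
    rcases Nat.mod_two_eq_zero_or_one m with h0 | h0
    · rw [if_pos h0, if_neg (by omega)]; abel
    · rw [if_neg (by omega), if_pos (by omega)]; abel
  have sum2 : ∀ m a, m + 1 = s + s →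
      v m a + next (2 * (s + s)) r v m a = m • t + (c (q a) + c (p' a)) := by
    intro m a hm
    simp only [hv, next, if_pos (show m + 1 < 2 * (s + s) by omega),
      if_neg (show ¬ m + 1 < s + s by omega), if_pos (show m < s + s by omega)]
    have h1 : m / 2 + (m + 1) / 2 = m := by omega
    have h2 : m • t = (m / 2) • t + ((m + 1) / 2) • t := by rw [← add_nsmul, h1]
    rw [h2, if_neg (by omega), if_pos (by omega)]
    abel
  have sum3 : ∀ m a, m + 1 < s + s →
      v (s + s + m) a + next (2 * (s + s)) r v (s + s + m) a =
        m • t + (c (p' a) + c (q' a) + c d) := by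
    intro m a hm
    simp only [hv, next, if_pos (show s + s + m + 1 < 2 * (s + s) by omega),
      if_neg (show ¬ s + s + m + 1 < s + s by omega), if_neg (show ¬ s + s + m < s + s by omega)]
    -- Here the multiples of `t` add up to `k + m`; the surplus `k t` is the constant `d` of the
    -- table.
    rw [show c d = (s + s) • t from hkt.symm]
    have h1 : m • t + (s + s) • t = ((s + s + m) / 2) • t + ((s + s + m + 1) / 2) • t := by
      rw [← add_nsmul, ← add_nsmul]; congr 1; omega
    rw [← add_assoc, ← add_assoc, ← add_assoc, add_right_comm _ _ ((s + s) • t),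
      add_right_comm _ _ ((s + s) • t), h1]
    rcases Nat.mod_two_eq_zero_or_one m with h0 | h0
    · rw [if_pos (by omega), if_neg (by omega)]; abel
    · rw [if_neg (by omega), if_pos (by omega)]; abel
  have sum4 : ∀ m a, m + 1 = s + s →
      v (s + s + m) a + next (2 * (s + s)) r v (s + s + m) a =
        -- The last column is followed by column `0` of the next row, so the sum has no surplus `k
        -- t` and no `d`.
        m • t + (c (q' a) + c (p ((a + 1) % r))) := by
    intro m a hm
    simp only [hv, next, if_neg (show ¬ s + s + m + 1 < 2 * (s + s) by omega),
      if_neg (show ¬ s + s + m < s + s by omega), if_pos hk0]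
    rw [if_neg (by omega), show (s + s + m) / 2 = m by omega]
    simp [add_assoc]
  refine cyclicallyHarmonious_of_array (2 * (s + s)) r v (by rw [hcard]; ring) ?_ ?_
  · intro m hm a ha m' hm' a' ha' h
    have mem : ∀ m a, a < r → c (if m < s + s then (if m % 2 = 0 then p a else q a) else
        (if m % 2 = 0 then p' a else q' a)) ∈ K := by
      intro m a ha
      apply hcK
      split_ifs
      exacts [H.ltp a ha, H.ltq a ha, H.ltp' a ha, H.ltq' a ha]
    obtain ⟨h1, h2⟩ := cls _ _ (by omega) (by omega) _ (mem m a ha) _ (mem m' a' ha') h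
    have lts : ∀ m a, a < r → (if m < s + s then (if m % 2 = 0 then p a else q a) else
        (if m % 2 = 0 then p' a else q' a)) < 2 * r := by
      intro m a ha
      split_ifs
      exacts [H.ltp a ha, H.ltq a ha, H.ltp' a ha, H.ltq' a ha]
    have h3 := hc.inj _ (lts m a ha) _ (lts m' a' ha') h2
    -- As `k` is even, two columns over the same coset belong to the same half of the row;
    -- complementarity of the two listings then separates them.
    have h4 : m < s + s ↔ m' < s + s := by omega
    simp only [h4] at h3
    split_ifs at h3 with x1 x2 x3 x3 x2 x3 x3
    · exact ⟨by omega, H.injp a ha a' ha' h3⟩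
    · exact absurd h3 (H.ne a ha a' ha')
    · exact absurd h3.symm (H.ne a' ha' a ha)
    · exact ⟨by omega, H.injq a ha a' ha' h3⟩
    · exact ⟨by omega, H.injp' a ha a' ha' h3⟩
    · exact absurd h3 (H.ne' a ha a' ha')
    · exact absurd h3.symm (H.ne' a' ha' a ha)
    · exact ⟨by omega, H.injq' a ha a' ha' h3⟩
  · have mem1 : ∀ a < r, c (p a) + c (q a) ∈ K := fun a ha =>
      K.add_mem (hcK _ (H.ltp a ha)) (hcK _ (H.ltq a ha))
    have mem2 : ∀ a < r, c (q a) + c (p' a) ∈ K := fun a ha =>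
      K.add_mem (hcK _ (H.ltq a ha)) (hcK _ (H.ltp' a ha))
    have mem3 : ∀ a < r, c (p' a) + c (q' a) + c d ∈ K := fun a ha =>
      K.add_mem (K.add_mem (hcK _ (H.ltp' a ha)) (hcK _ (H.ltq' a ha))) (hcK d hd)
    have mem4 : ∀ a < r, c (q' a) + c (p ((a + 1) % r)) ∈ K := fun a ha =>
      K.add_mem (hcK _ (H.ltq' a ha)) (hcK _ (H.ltp _ (lt1 a)))
    have ne13 : ∀ a < r, ∀ b < r, c (p a) + c (q a) ≠ c (p' b) + c (q' b) + c d := by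
      intro a ha b hb h
      rw [hc.add _ (H.ltp' b hb) _ (H.ltq' b hb)] at h
      exact H.nepq a ha b hb (hc.add_eq ht (H.ltp a ha) (H.ltq a ha)
        (ht.closed _ (H.ltp' b hb) _ (H.ltq' b hb)) hd h)
    have ne24 : ∀ a < r, ∀ b < r, c (q a) + c (p' a) ≠ c (q' b) + c (p ((b + 1) % r)) :=
      fun a ha b hb h => H.neqp a ha b hb (hc.add_eq ht (H.ltq a ha) (H.ltp' a ha) (H.ltq' b hb)
        (H.ltp _ (lt1 b)) h)
    have form : ∀ m < 2 * (s + s), ∃ e < s + s, ((m = e ∧ e + 1 < s + s) ∨ (m = e ∧ e + 1 = s + s) ∨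
        (m = s + s + e ∧ e + 1 < s + s) ∨ (m = s + s + e ∧ e + 1 = s + s)) := by
      intro m hm
      by_cases h : m < s + s
      · exact ⟨m, h, by omega⟩
      · exact ⟨m - (s + s), by omega, by omega⟩
    intro m hm a ha m' hm' a' ha' h
    obtain ⟨e, he, h1⟩ := form m hm
    obtain ⟨e', he', h1'⟩ := form m' hm'
    rcases h1 with ⟨rfl, h1⟩ | ⟨rfl, h1⟩ | ⟨rfl, h1⟩ | ⟨rfl, h1⟩
    · rw [sum1 _ _ h1] at h
      rcases h1' with ⟨rfl, h1'⟩ | ⟨rfl, h1'⟩ | ⟨rfl, h1'⟩ | ⟨rfl, h1'⟩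
      · rw [sum1 _ _ h1'] at h
        obtain ⟨rfl, h2⟩ := cls _ _ he he' _ (mem1 a ha) _ (mem1 a' ha') h
        exact ⟨rfl, H.injpq a ha a' ha' (hc.add_eq ht (H.ltp a ha) (H.ltq a ha) (H.ltp a' ha')
          (H.ltq a' ha') h2)⟩
      · rw [sum2 _ _ h1'] at h
        have := (cls _ _ he he' _ (mem1 a ha) _ (mem2 a' ha') h).1
        omega
      · rw [sum3 _ _ h1'] at h
        exact absurd (cls _ _ he he' _ (mem1 a ha) _ (mem3 a' ha') h).2 (ne13 a ha a' ha')
      · rw [sum4 _ _ h1'] at h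
        have := (cls _ _ he he' _ (mem1 a ha) _ (mem4 a' ha') h).1
        omega
    · rw [sum2 _ _ h1] at h
      rcases h1' with ⟨rfl, h1'⟩ | ⟨rfl, h1'⟩ | ⟨rfl, h1'⟩ | ⟨rfl, h1'⟩
      · rw [sum1 _ _ h1'] at h
        have := (cls _ _ he he' _ (mem2 a ha) _ (mem1 a' ha') h).1
        omega
      · rw [sum2 _ _ h1'] at h
        obtain ⟨rfl, h2⟩ := cls _ _ he he' _ (mem2 a ha) _ (mem2 a' ha') h
        exact ⟨rfl, H.injqp a ha a' ha' (hc.add_eq ht (H.ltq a ha) (H.ltp' a ha) (H.ltq a' ha')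
          (H.ltp' a' ha') h2)⟩
      · rw [sum3 _ _ h1'] at h
        have := (cls _ _ he he' _ (mem2 a ha) _ (mem3 a' ha') h).1
        omega
      · rw [sum4 _ _ h1'] at h
        exact absurd (cls _ _ he he' _ (mem2 a ha) _ (mem4 a' ha') h).2 (ne24 a ha a' ha')
    · rw [sum3 _ _ h1] at h
      rcases h1' with ⟨rfl, h1'⟩ | ⟨rfl, h1'⟩ | ⟨rfl, h1'⟩ | ⟨rfl, h1'⟩
      · rw [sum1 _ _ h1'] at h
        exact absurd (cls _ _ he he' _ (mem3 a ha) _ (mem1 a' ha') h).2.symm (ne13 a' ha' a ha)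
      · rw [sum2 _ _ h1'] at h
        have := (cls _ _ he he' _ (mem3 a ha) _ (mem2 a' ha') h).1
        omega
      · rw [sum3 _ _ h1'] at h
        obtain ⟨rfl, h2⟩ := cls _ _ he he' _ (mem3 a ha) _ (mem3 a' ha') h
        exact ⟨rfl, H.injpq' a ha a' ha' (hc.add_eq ht (H.ltp' a ha) (H.ltq' a ha) (H.ltp' a' ha')
          (H.ltq' a' ha') (add_right_cancel h2))⟩
      · rw [sum4 _ _ h1'] at h
        have := (cls _ _ he he' _ (mem3 a ha) _ (mem4 a' ha') h).1
        omega
    · rw [sum4 _ _ h1] at h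
      rcases h1' with ⟨rfl, h1'⟩ | ⟨rfl, h1'⟩ | ⟨rfl, h1'⟩ | ⟨rfl, h1'⟩
      · rw [sum1 _ _ h1'] at h
        have := (cls _ _ he he' _ (mem4 a ha) _ (mem1 a' ha') h).1
        omega
      · rw [sum2 _ _ h1'] at h
        exact absurd (cls _ _ he he' _ (mem4 a ha) _ (mem2 a' ha') h).2.symm (ne24 a' ha' a ha)
      · rw [sum3 _ _ h1'] at h
        have := (cls _ _ he he' _ (mem4 a ha) _ (mem3 a' ha') h).1
        omega
      · rw [sum4 _ _ h1'] at h
        obtain ⟨h3, h2⟩ := cls _ _ he he' _ (mem4 a ha) _ (mem4 a' ha') h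
        exact ⟨by omega, H.injqp' a ha a' ha' (hc.add_eq ht (H.ltq' a ha) (H.ltp _ (lt1 a))
          (H.ltq' a' ha') (H.ltp _ (lt1 a')) h2)⟩

/-! ### Explicit tables, verified by evaluation -/

/-- The function that lists the entries of `l`. -/
def listEntry (l : List ℕ) (a : ℕ) : ℕ := l.getD a 0

/-- The addition table of `ℤ/2 × ℤ/4`, the pair `(x, y)` having the number `4 x + y`. -/
def addTwoFour (a b : ℕ) : ℕ := (a / 4 + b / 4) % 2 * 4 + (a + b) % 4

theorem isTable_addTwoFour : IsTable 8 addTwoFour :=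
  ⟨by decide, by decide, by decide⟩

theorem isTable_xor (j : ℕ) : IsTable (2 ^ j) (· ^^^ ·) :=
  ⟨by positivity, fun _ ha _ hb => Nat.xor_lt_two_pow ha hb, fun a ha => ⟨a, ha, Nat.xor_self a⟩⟩

theorem evenListing_addTwoFour : EvenListing 8 addTwoFour (listEntry [0, 2, 6, 1, 4, 5, 3, 7])
    (listEntry [1, 6, 4, 5, 3, 7, 0, 2]) := by
  constructor <;> decide +kernel

theorem evenListing_xor_four : EvenListing (2 ^ 4) (· ^^^ ·) (fun a => a) (listEntry [0, 2, 4,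
    1, 11, 13, 10, 14, 6, 3, 7, 15, 9, 12, 5, 8]) := by
  constructor <;> decide +kernel

theorem oddListing_xor_four : OddListing (2 ^ 4) (· ^^^ ·) (listEntry [0, 7, 8, 6, 9, 13, 2, 15,
    1, 5, 12, 14, 11, 4, 3, 10]) (listEntry [2, 11, 8, 9, 3, 4, 7, 12, 6, 13, 10, 15, 5, 0, 14,
    1]) (listEntry [7, 5, 8, 3, 14, 0, 11, 10, 9, 4, 1, 12, 13, 2, 15, 6]) := by
  constructor <;> decide +kernel

theorem oddListing_xor_five : OddListing (2 ^ 5) (· ^^^ ·) (listEntry [0, 5, 18, 8, 25, 17, 13,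
    27, 4, 10, 2, 28, 22, 19, 3, 23, 16, 12, 29, 11, 30, 9, 6, 26, 7, 20, 15, 1, 21, 31, 24,
    14]) (listEntry [25, 13, 21, 12, 6, 10, 28, 18, 1, 9, 14, 30, 5, 29, 19, 24, 2, 16, 27, 22,
    4, 3, 11, 15, 7, 31, 17, 23, 20, 8, 0, 26]) (listEntry [6, 28, 20, 16, 11, 9, 30, 21, 23, 3,
    26, 4, 13, 27, 29, 0, 14, 2, 18, 5, 1, 19, 22, 17, 7, 8, 10, 24, 31, 12, 25, 15]) := by
  constructor <;> decide +kernel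

/-- One value of `d` suffices for an elementary abelian table: any nonzero element can be given the
code `1`, see `exists_coding`. -/
theorem halfListing_xor_three : HalfListing (2 ^ 2) (· ^^^ ·) 1 (listEntry [0, 2, 5, 4])
    (listEntry [6, 3, 7, 1]) (listEntry [5, 1, 7, 6]) (listEntry [3, 0, 2, 4]) := by
  constructor <;> decide +kernel

theorem halfListing_xor_four : HalfListing (2 ^ 3) (· ^^^ ·) 1 (listEntry [12, 14, 5, 0, 7, 13,
    1, 11]) (listEntry [15, 6, 8, 9, 3, 2, 4, 10]) (listEntry [8, 0, 6, 2, 3, 15, 7, 5])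
    (listEntry [11, 1, 12, 13, 4, 9, 10, 14]) := by
  constructor <;> decide +kernel

theorem halfListing_xor_five : HalfListing (2 ^ 4) (· ^^^ ·) 1 (listEntry [22, 30, 12, 29, 8,
    13, 19, 4, 0, 1, 18, 3, 9, 7, 16, 11]) (listEntry [25, 31, 15, 14, 17, 23, 6, 20, 5, 10, 24,
    27, 21, 28, 2, 26]) (listEntry [25, 29, 3, 13, 27, 9, 14, 11, 30, 23, 10, 21, 26, 15, 20,
    17]) (listEntry [24, 8, 5, 18, 28, 4, 1, 7, 0, 31, 22, 16, 19, 12, 2, 6]) := by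
  constructor <;> decide +kernel

/-- When the quotient by `ℤ/2 × ℤ/4` is cyclic of order `k`, the element `k t` can be any of the
eight elements, so each `d` gets its own table. -/
theorem exists_halfListing_addTwoFour (d : ℕ) (hd : d < 8) :
    ∃ p q p' q', HalfListing 4 addTwoFour d p q p' q' := by
  interval_cases d
  · refine ⟨listEntry [4, 2, 3, 1], listEntry [5, 0, 6, 7], listEntry [0, 2, 7, 4], listEntry [6,
      1, 5, 3], ?_⟩
    constructor <;> decide
  · refine ⟨listEntry [1, 3, 0, 7], listEntry [2, 6, 4, 5], listEntry [2, 4, 3, 6], listEntry [7,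
      5, 1, 0], ?_⟩
    constructor <;> decide
  · refine ⟨listEntry [7, 1, 5, 2], listEntry [3, 4, 6, 0], listEntry [2, 1, 6, 3], listEntry [7,
      5, 4, 0], ?_⟩
    constructor <;> decide
  · refine ⟨listEntry [0, 4, 6, 5], listEntry [3, 1, 7, 2], listEntry [1, 6, 4, 0], listEntry [2,
      7, 3, 5], ?_⟩
    constructor <;> decide
  · refine ⟨listEntry [2, 3, 0, 6], listEntry [1, 7, 5, 4], listEntry [3, 1, 4, 7], listEntry [6,
      2, 0, 5], ?_⟩
    constructor <;> decide
  · refine ⟨listEntry [7, 2, 1, 5], listEntry [6, 4, 3, 0], listEntry [6, 7, 5, 2], listEntry [3,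
      4, 1, 0], ?_⟩
    constructor <;> decide
  · refine ⟨listEntry [5, 7, 3, 2], listEntry [0, 6, 1, 4], listEntry [0, 4, 5, 7], listEntry [1,
      6, 3, 2], ?_⟩
    constructor <;> decide
  · refine ⟨listEntry [0, 6, 5, 2], listEntry [3, 4, 1, 7], listEntry [2, 0, 1, 5], listEntry [3,
      6, 4, 7], ?_⟩
    constructor <;> decide

/-! ### Coding subgroups by numbers -/

theorem isCoding_addTwoFour {G : Type*} [AddCommGroup G] {w u : G} (hw : 2 • w = 0)
    (hu : 4 • u = 0) (hw0 : w ≠ 0) (hu0 : 2 • u ≠ 0) (hwu : w ≠ 2 • u) :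
    IsCoding 8 addTwoFour (fun a => (a / 4) • w + (a % 4) • u) := by
  have hmod2 : ∀ m : ℕ, (m % 2) • w = m • w := fun m => by
    conv_rhs => rw [← Nat.div_add_mod m 2, add_nsmul, mul_nsmul, hw, smul_zero, zero_add]
  have hmod4 : ∀ m : ℕ, (m % 4) • u = m • u := fun m => by
    conv_rhs => rw [← Nat.div_add_mod m 4, add_nsmul, mul_nsmul, hu, smul_zero, zero_add]
  have hadd : ∀ a b : ℕ, (a / 4) • w + (a % 4) • u + ((b / 4) • w + (b % 4) • u) =
      (addTwoFour a b / 4) • w + (addTwoFour a b % 4) • u := by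
    intro a b
    have h1 : addTwoFour a b / 4 = (a / 4 + b / 4) % 2 := by unfold addTwoFour; omega
    have h2 : addTwoFour a b % 4 = (a + b) % 4 := by unfold addTwoFour; omega
    rw [h1, h2, hmod2, hmod4, hmod4, hmod4, add_nsmul, add_nsmul]
    abel
  have hneg : -(2 • u : G) = 2 • u := by
    rw [neg_eq_iff_add_eq_zero, ← add_nsmul]; exact hu
  have hker : ∀ a < 8, (a / 4) • w + (a % 4) • u = 0 → a = 0 := by
    intro a ha h
    have h3u : ∀ x : G, 3 • u = x → 2 • x = 2 • u := by
      rintro x rfl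
      rw [← mul_nsmul, show 3 * 2 = 4 + 2 from rfl, add_nsmul, hu, zero_add]
    interval_cases a
    · rfl
    · exact absurd (by simpa using h) (fun h : u = 0 => hu0 (by rw [h, smul_zero]))
    · exact absurd (by simpa using h) hu0
    · exact absurd (h3u 0 (by simpa using h)) (by simpa using hu0.symm)
    · exact absurd (by simpa using h) hw0
    · have h1 : w + u = 0 := by simpa using h
      have h2 : 2 • (w + u) = 0 := by rw [h1, smul_zero]
      rw [smul_add, hw, zero_add] at h2
      exact absurd h2 hu0
    · have h1 : w + 2 • u = 0 := by simpa using h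
      exact absurd (by rw [eq_neg_of_add_eq_zero_left h1, hneg]) hwu
    · have h1 : w + 3 • u = 0 := by simpa using h
      have h2 : 2 • (w + 3 • u) = 0 := by rw [h1, smul_zero]
      rw [smul_add, hw, zero_add, h3u _ rfl] at h2
      exact absurd h2 hu0
  refine ⟨by simp, fun a _ b _ => hadd a b, fun a ha b hb h => ?_⟩
  -- Injectivity follows from the trivial kernel by adding the inverse `b'` of `b`; the table shows
  -- that only `b` is cancelled by `b'`.
  have inv : ∀ b < 8, ∃ b' < 8, addTwoFour b b' = 0 ∧
      ∀ a < 8, addTwoFour a b' = 0 → a = b := by decide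
  obtain ⟨b', hb', h1, h2⟩ := inv b hb
  refine h2 a ha (hker _ (isTable_addTwoFour.closed a ha b' hb') ?_)
  rw [← hadd, h, hadd, h1]
  simp

/-- The combination of the elements `w 0, …, w (j - 1)` that is given by the binary digits of a
number. -/
def digitSum {G : Type*} [AddCommGroup G] (w : ℕ → G) : ℕ → ℕ → G
  | 0, _ => 0
  | j + 1, a => digitSum w j a + if a.testBit j then w j else 0

theorem digitSum_add {G : Type*} [AddCommGroup G] {w : ℕ → G} (hw : ∀ i, w i + w i = 0)
    (j a b : ℕ) : digitSum w j a + digitSum w j b = digitSum w j (a ^^^ b) := by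
  induction j with
  | zero => simp [digitSum]
  | succ j ih =>
    have h : ∀ x y z t : G, x + y + (z + t) = x + z + (y + t) := fun x y z t => by abel
    simp only [digitSum, Nat.testBit_xor]
    rw [h, ih]
    cases a.testBit j <;> cases b.testBit j <;> simp [hw]

theorem digitSum_zero {G : Type*} [AddCommGroup G] (w : ℕ → G) (j : ℕ) : digitSum w j 0 = 0 := by
  induction j with
  | zero => rfl
  | succ j ih => simp [digitSum, ih]

/-- Each `w i` lies outside the span of its predecessors, so a vanishing digit sum has top digit
`0`, and descent on the top digit shows that the kernel is trivial. -/
theorem isCoding_digitSum {G : Type*} [AddCommGroup G] {w : ℕ → G} (hw : ∀ i, w i + w i = 0)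
    (j : ℕ) (hind : ∀ i < j, ∀ a, digitSum w i a ≠ w i) :
    IsCoding (2 ^ j) (· ^^^ ·) (digitSum w j) := by
  have ker : ∀ i ≤ j, ∀ x < 2 ^ i, digitSum w i x = 0 → x = 0 := by
    intro i
    induction i with
    | zero => intro _ x hx _; simpa using hx
    | succ i ih =>
      intro hi x hx h
      unfold digitSum at h
      by_cases hb : x.testBit i
      · rw [if_pos hb] at h
        exact absurd (by rw [eq_neg_of_add_eq_zero_left h, neg_eq_iff_add_eq_zero, hw])
          (hind i hi x)
      · rw [if_neg hb, add_zero] at h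
        refine ih (by omega) x (Nat.lt_pow_two_of_testBit x fun l hl => ?_) h
        rcases hl.eq_or_lt with rfl | hl
        · simpa using hb
        · exact Nat.testBit_lt_two_pow (hx.trans_le (Nat.pow_le_pow_right two_pos hl))
  refine ⟨digitSum_zero w j, fun a _ b _ => digitSum_add hw j a b, fun a ha b hb h => ?_⟩
  have h1 : digitSum w j (a ^^^ b) = 0 := by
    rw [← digitSum_add hw, h, digitSum_add hw, Nat.xor_self, digitSum_zero]
  exact Nat.xor_eq_zero_iff.1 (ker j le_rfl _ (Nat.xor_lt_two_pow ha hb) h1)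

/-! ### Direct listings of `(ℤ/2)² × ℤ/k` and `(ℤ/2)³ × ℤ/k` for odd `k` -/

theorem cyclicallyHarmonious_of_surjective {G : Type*} [AddCommGroup G] (h : ℕ → G)
    (hv : ∀ g, ∃ j < Nat.card G, h j = g)
    (he : ∀ g, ∃ j < Nat.card G, h j + h ((j + 1) % Nat.card G) = g) :
    CyclicallyHarmonious G := by
  have key : ∀ f : ℕ → G, (∀ g, ∃ j < Nat.card G, f j = g) →
      ∀ i < Nat.card G, ∀ j < Nat.card G, f i = f j → i = j := by
    intro f hf i hi j hj hij
    have hs : Function.Surjective (fun a : Fin (Nat.card G) => f a) := fun g => by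
      obtain ⟨j, hj, h⟩ := hf g
      exact ⟨⟨j, hj⟩, h⟩
    have hb := hs.bijective_of_nat_card_le (by simp)
    exact congrArg Fin.val (hb.1 (a₁ := ⟨i, hi⟩) (a₂ := ⟨j, hj⟩) hij)
  exact ⟨h, key h hv, key (fun j => h j + h ((j + 1) % Nat.card G)) he⟩

theorem getD_lt {l : List ℕ} {n : ℕ} (hn : 0 < n) (h : ∀ a ∈ l, a < n) (i : ℕ) :
    l.getD i 0 < n := by
  rw [List.getD_eq_getElem?_getD]
  rcases hi : l[i]? with _ | a
  · exact hn
  · exact h a (List.mem_of_getElem? hi)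

/-- A cyclic listing of `(ℤ/2)^e × ℤ/k`, `k` odd, given by the codes `f` of the first and by integer
representatives `z` of the second components. -/
theorem cyclicallyHarmonious_of_codes {G : Type*} [AddCommGroup G] {e k : ℕ}
    {c : ℕ → G} (hc : IsCoding (2 ^ e) (· ^^^ ·) c) {t : G} (hk : Odd k) (hkt : k • t = 0)
    (hgen : ∀ g, ∃ a < 2 ^ e, ∃ y : ℤ, g = c a + y • t) (hcard : Nat.card G = 2 ^ e * k)
    (f : ℕ → ℕ) (z : ℕ → ℤ) (hf : ∀ j, f j < 2 ^ e)
    (hv : ∀ a < 2 ^ e, ∃ lo : ℤ, ∀ y, lo ≤ y → y < lo + k → ∃ j < 2 ^ e * k, f j = a ∧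
      (z j = y ∨ z j = y + k ∨ z j = y - k))
    (he : ∀ a < 2 ^ e, ∃ lo par : ℤ, ∀ y, lo ≤ y → y < lo + k → ∃ j < 2 ^ e * k, ∃ j',
      (j + 1 < 2 ^ e * k ∧ j' = j + 1 ∨ j + 1 = 2 ^ e * k ∧ j' = 0) ∧ f j ^^^ f j' = a ∧
      (z j + z j' = 2 * y + par ∨ z j + z j' = 2 * y + par + k ∨ z j + z j' = 2 * y + par - k)) :
    CyclicallyHarmonious G := by
  have hkt' : (k : ℤ) • t = 0 := by rw [natCast_zsmul]; exact hkt
  have hk0 : (0 : ℤ) < k := by exact_mod_cast hk.pos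
  have shift : ∀ x y : ℤ, (x = y ∨ x = y + k ∨ x = y - k) → x • t = y • t := by
    rintro x y (rfl | rfl | rfl)
    · rfl
    · rw [add_zsmul, hkt', add_zero]
    · rw [sub_eq_add_neg, add_zsmul, neg_zsmul, hkt', neg_zero, add_zero]
  have dvd : ∀ x y : ℤ, (k : ℤ) ∣ x - y → x • t = y • t := by
    rintro x y ⟨d, h⟩
    rw [eq_add_of_sub_eq h, add_zsmul, mul_comm, mul_zsmul, hkt', zsmul_zero, zero_add]
  have window : ∀ lo x : ℤ, ∃ y, lo ≤ y ∧ y < lo + k ∧ (k : ℤ) ∣ x - y := by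
    intro lo x
    have h1 := Int.emod_nonneg (x - lo) hk0.ne'
    have h2 := Int.emod_lt_of_pos (x - lo) hk0
    refine ⟨lo + (x - lo) % k, by omega, by omega, ?_⟩
    rw [← sub_sub]
    exact Int.dvd_self_sub_emod
  refine cyclicallyHarmonious_of_surjective (fun j => c (f j) + z j • t) ?_ ?_
  · intro g
    obtain ⟨a, ha, x, rfl⟩ := hgen g
    obtain ⟨lo, hlo⟩ := hv a ha
    obtain ⟨y, h1, h2, h3⟩ := window lo x
    obtain ⟨j, hj, hfj, hzj⟩ := hlo y h1 h2
    refine ⟨j, hcard ▸ hj, ?_⟩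
    show c (f j) + z j • t = _
    rw [hfj, shift _ _ hzj, dvd _ _ h3]
  · intro g
    obtain ⟨a, ha, x, rfl⟩ := hgen g
    obtain ⟨lo, par, hlo⟩ := he a ha
    obtain ⟨s, hs⟩ := hk
    -- With `k = 2s + 1`, the number `s + 1` is the inverse of `2` modulo `k`, so this `y` solves
    -- `2y + par = x` modulo `k`.
    obtain ⟨y, h1, h2, d, h3⟩ := window lo ((x - par) * (s + 1))
    obtain ⟨j, hj, j', hjj, hfj, hzj⟩ := hlo y h1 h2
    refine ⟨j, hcard ▸ hj, ?_⟩
    have hj' : (j + 1) % Nat.card G = j' := by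
      rw [hcard]
      rcases hjj with ⟨h4, rfl⟩ | ⟨h4, rfl⟩
      · exact Nat.mod_eq_of_lt h4
      · rw [h4, Nat.mod_self]
    have hxy : (k : ℤ) ∣ x - (2 * y + par) := by
      refine ⟨2 * d - (x - par), ?_⟩
      have : (k : ℤ) = 2 * s + 1 := by exact_mod_cast hs
      rw [this] at h3 ⊢
      linear_combination 2 * h3
    simp only [hj']
    rw [dvd _ _ hxy, ← shift _ _ hzj, ← hfj, ← hc.add _ (hf j) _ (hf j'), add_zsmul]
    abel

/-- The groups `(ℤ/2)² × ℤ/k` with `k > 1` odd. -/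
theorem cyclicallyHarmonious_of_coding_four {G : Type*} [AddCommGroup G] {k : ℕ}
    {c : ℕ → G} (hc : IsCoding (2 ^ 2) (· ^^^ ·) c) {t : G} (hk : Odd k) (hk1 : 1 < k)
    (hkt : k • t = 0) (hgen : ∀ g, ∃ a < 2 ^ 2, ∃ y : ℤ, g = c a + y • t)
    (hcard : Nat.card G = 2 ^ 2 * k) : CyclicallyHarmonious G := by
  have hk3 : 3 ≤ k := by obtain ⟨s, rfl⟩ := hk; omega
  -- The repeated block `1, 2, 3` lists the powers of a generator of the multiplicative group of the
  -- field with four elements; sums of cyclic neighbours again run through all nonzero elements. The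
  -- code `0` comes mostly in one run, and the tail supplies the elements and sums still missing.
  obtain ⟨f, hfd⟩ : ∃ f : ℕ → ℕ, f = fun j => if j < 3 * (k - 1) then [1, 2, 3].getD (j % 3) 0
    else if j = 3 * k - 3 then 3 else if j < 4 * k - 4 then 0 else [2, 0, 0, 1].getD (j - (4 * k -
    4)) 0 := ⟨_, rfl⟩
  obtain ⟨z, hzd⟩ : ∃ z : ℕ → ℤ, z = fun j => if j < 3 * (k - 1) then ((j / 3 : ℕ) : ℤ) + ([1, 1,
    0] : List ℤ).getD (j % 3) 0 else if j = 3 * k - 3 then -1 else if j < 4 * k - 4 then (j : ℤ) -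
    3 * k + 3 else ([0, 0, -1, 0] : List ℤ).getD (j - (4 * k - 4)) 0 := ⟨_, rfl⟩
  have core0 : ∀ m, m + 1 < k →
      f (3 * m + 0) = 1 ∧ z (3 * m + 0) = m + 1 := by
    intro m hm
    simp only [hfd, hzd]
    rw [if_pos (by omega), if_pos (by omega), show (3 * m + 0) % 3 = 0 by omega,
      show (3 * m + 0) / 3 = m by omega]
    exact ⟨rfl, rfl⟩
  have core1 : ∀ m, m + 1 < k →
      f (3 * m + 1) = 2 ∧ z (3 * m + 1) = m + 1 := by
    intro m hm
    simp only [hfd, hzd]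
    rw [if_pos (by omega), if_pos (by omega), show (3 * m + 1) % 3 = 1 by omega,
      show (3 * m + 1) / 3 = m by omega]
    exact ⟨rfl, rfl⟩
  have core2 : ∀ m, m + 1 < k →
      f (3 * m + 2) = 3 ∧ z (3 * m + 2) = m + 0 := by
    intro m hm
    simp only [hfd, hzd]
    rw [if_pos (by omega), if_pos (by omega), show (3 * m + 2) % 3 = 2 by omega,
      show (3 * m + 2) / 3 = m by omega]
    exact ⟨rfl, rfl⟩
  have tail0 : f (3 * k - 3) = 3 ∧ z (3 * k - 3) = -1 := by
    simp only [hfd, hzd]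
    exact ⟨by rw [if_neg (by omega), if_pos trivial], by rw [if_neg (by omega), if_pos trivial]⟩
  have run : ∀ m, m + 2 < k → f (3 * k - 2 + m) = 0 ∧ z (3 * k - 2 + m) = m + 1 := by
    intro m hm
    simp only [hfd, hzd]
    constructor
    · rw [if_neg (by omega), if_neg (by omega), if_pos (by omega)]
    · rw [if_neg (by omega), if_neg (by omega), if_pos (by omega)]
      omega
  have tail2 : f (4 * k - 4) = 2 ∧ z (4 * k - 4) = 0 := by
    simp only [hfd, hzd]
    constructor <;>
    · rw [if_neg (by omega), if_neg (by omega), if_neg (by omega),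
        show 4 * k - 4 - (4 * k - 4) = 0 by omega]
      rfl
  have tail3 : f (4 * k - 3) = 0 ∧ z (4 * k - 3) = 0 := by
    simp only [hfd, hzd]
    constructor <;>
    · rw [if_neg (by omega), if_neg (by omega), if_neg (by omega),
        show 4 * k - 3 - (4 * k - 4) = 1 by omega]
      rfl
  have tail4 : f (4 * k - 2) = 0 ∧ z (4 * k - 2) = -1 := by
    simp only [hfd, hzd]
    constructor <;>
    · rw [if_neg (by omega), if_neg (by omega), if_neg (by omega),
        show 4 * k - 2 - (4 * k - 4) = 2 by omega]
      rfl
  have tail5 : f (4 * k - 1) = 1 ∧ z (4 * k - 1) = 0 := by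
    simp only [hfd, hzd]
    constructor <;>
    · rw [if_neg (by omega), if_neg (by omega), if_neg (by omega),
        show 4 * k - 1 - (4 * k - 4) = 3 by omega]
      rfl
  refine cyclicallyHarmonious_of_codes hc hk hkt hgen hcard f z ?_ ?_ ?_
  · intro j
    simp only [hfd]
    split_ifs
    · exact getD_lt (by decide) (by decide) _
    · decide
    · decide
    · exact getD_lt (by decide) (by decide) _
  · clear hfd hzd
    intro a ha
    norm_num at ha
    interval_cases a
    · refine ⟨-1, fun y h1 h2 => ?_⟩
      by_cases hy4 : y = -1
      · exact ⟨4 * k - 2, by omega, tail4.1, by omega⟩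
      by_cases hy3 : y = 0
      · exact ⟨4 * k - 3, by omega, tail3.1, by omega⟩
      have h3 := run (y - 1).toNat (by omega)
      exact ⟨3 * k - 2 + (y - 1).toNat, by omega, h3.1, by omega⟩
    · refine ⟨0, fun y h1 h2 => ?_⟩
      by_cases hy : y = 0
      · exact ⟨4 * k - 1, by omega, tail5.1, by omega⟩
      have h3 := core0 (y - 1).toNat (by omega)
      exact ⟨3 * (y - 1).toNat + 0, by omega, h3.1, by omega⟩
    · refine ⟨0, fun y h1 h2 => ?_⟩
      by_cases hy : y = 0
      · exact ⟨4 * k - 4, by omega, tail2.1, by omega⟩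
      have h3 := core1 (y - 1).toNat (by omega)
      exact ⟨3 * (y - 1).toNat + 1, by omega, h3.1, by omega⟩
    · refine ⟨-1, fun y h1 h2 => ?_⟩
      by_cases hy : y = -1
      · exact ⟨3 * k - 3, by omega, tail0.1, by omega⟩
      have h3 := core2 (y - 0).toNat (by omega)
      exact ⟨3 * (y - 0).toNat + 2, by omega, h3.1, by omega⟩
  -- For each code `a`, the second components of the sums form `k` terms of a progression of
  -- difference `2` modulo `k`. The blocks, or the run for `a = 0`, give the bulk; the joints and
  -- the tail give the exceptional values of `y`.
  · clear hfd hzd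
    intro a ha
    norm_num at ha
    interval_cases a
    · refine ⟨-2, 1, fun y h1 h2 => ?_⟩
      by_cases hy0 : y = -2
      · have h3 := core2 (k - 2) (by omega)
        have h4 := tail0
        refine ⟨3 * (k - 2) + 2, by omega, 3 * k - 3, by omega, ?_, by omega⟩
        rw [h3.1, h4.1]
        rfl
      by_cases hy1 : y = -1
      · have h3 := tail3
        have h4 := tail4
        refine ⟨4 * k - 3, by omega, 4 * k - 2, by omega, ?_, by omega⟩
        rw [h3.1, h4.1]
        rfl
      by_cases hy2 : y = 0
      · have h3 := tail5
        have h4 := core0 0 (by omega)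
        refine ⟨4 * k - 1, by omega, 3 * 0 + 0, by omega, ?_, by omega⟩
        rw [h3.1, h4.1]
        rfl
      have h3 := run (y - 1).toNat (by omega)
      have h4 := run ((y - 1).toNat + 1) (by omega)
      refine ⟨3 * k - 2 + (y - 1).toNat, by omega, 3 * k - 2 + ((y - 1).toNat + 1), by omega, ?_,
        by omega⟩
      rw [h3.1, h4.1]
      rfl
    · refine ⟨0, -1, fun y h1 h2 => ?_⟩
      by_cases hy0 : y = 0
      · have h3 := tail4
        have h4 := tail5
        refine ⟨4 * k - 2, by omega, 4 * k - 1, by omega, ?_, by omega⟩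
        rw [h3.1, h4.1]
        rfl
      have h3 := core1 (y - 1).toNat (by omega)
      have h4 := core2 (y - 1).toNat (by omega)
      refine ⟨3 * (y - 1).toNat + 1, by omega, 3 * (y - 1).toNat + 2, by omega, ?_, by omega⟩
      rw [h3.1, h4.1]
      rfl
    · refine ⟨-1, 0, fun y h1 h2 => ?_⟩
      by_cases hy0 : y = -1
      · have h3 := run (k - 3) (by omega)
        have h4 := tail2
        refine ⟨3 * k - 2 + (k - 3), by omega, 4 * k - 4, by omega, ?_, by omega⟩
        rw [h3.1, h4.1]
        rfl
      by_cases hy1 : y = 0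
      · have h3 := tail2
        have h4 := tail3
        refine ⟨4 * k - 4, by omega, 4 * k - 3, by omega, ?_, by omega⟩
        rw [h3.1, h4.1]
        rfl
      have h3 := core2 (y - 1).toNat (by omega)
      have h4 := core0 ((y - 1).toNat + 1) (by omega)
      refine ⟨3 * (y - 1).toNat + 2, by omega, 3 * ((y - 1).toNat + 1) + 0, by omega, ?_, by omega⟩
      rw [h3.1, h4.1]
      rfl
    · refine ⟨0, 0, fun y h1 h2 => ?_⟩
      by_cases hy0 : y = 0
      · have h3 := tail0
        have h4 := run 0 (by omega)
        refine ⟨3 * k - 3, by omega, 3 * k - 2 + 0, by omega, ?_, by omega⟩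
        rw [h3.1, h4.1]
        rfl
      have h3 := core0 (y - 1).toNat (by omega)
      have h4 := core1 (y - 1).toNat (by omega)
      refine ⟨3 * (y - 1).toNat + 0, by omega, 3 * (y - 1).toNat + 1, by omega, ?_, by omega⟩
      rw [h3.1, h4.1]
      rfl

/-- The groups `(ℤ/2)³ × ℤ/k` with `k > 1` odd. -/
theorem cyclicallyHarmonious_of_coding_eight {G : Type*} [AddCommGroup G] {k : ℕ}
    {c : ℕ → G} (hc : IsCoding (2 ^ 3) (· ^^^ ·) c) {t : G} (hk : Odd k) (hk1 : 1 < k)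
    (hkt : k • t = 0) (hgen : ∀ g, ∃ a < 2 ^ 3, ∃ y : ℤ, g = c a + y • t)
    (hcard : Nat.card G = 2 ^ 3 * k) : CyclicallyHarmonious G := by
  have hk3 : 3 ≤ k := by obtain ⟨s, rfl⟩ := hk; omega
  -- Same design: `1, 2, 4, 3, 6, 7, 5` are the powers of a root of `x³ = x + 1` in the field with
  -- eight elements, so neighbour sums are these powers times `1 + x`.
  obtain ⟨f, hfd⟩ : ∃ f : ℕ → ℕ, f = fun j => if j < 7 * (k - 1) then [1, 2, 4, 3, 6, 7, 5].getD
    (j % 7) 0 else if j = 7 * k - 7 then 5 else if j < 8 * k - 7 then 0 else [4, 3, 7, 6, 0, 2,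
    1].getD (j - (8 * k - 7)) 0 := ⟨_, rfl⟩
  obtain ⟨z, hzd⟩ : ∃ z : ℕ → ℤ, z = fun j => if j < 7 * (k - 1) then ((j / 7 : ℕ) : ℤ) + ([1, 2,
    1, 1, 2, 2, 1] : List ℤ).getD (j % 7) 0 else if j = 7 * k - 7 then 0 else if j < 8 * k - 7
    then (j : ℤ) - 7 * k + 7 else ([0, 0, 1, 1, 0, 1, 0] : List ℤ).getD (j - (8 * k - 7)) 0 := ⟨_,
    rfl⟩
  have core0 : ∀ m, m + 1 < k →
      f (7 * m + 0) = 1 ∧ z (7 * m + 0) = m + 1 := by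
    intro m hm
    simp only [hfd, hzd]
    rw [if_pos (by omega), if_pos (by omega), show (7 * m + 0) % 7 = 0 by omega,
      show (7 * m + 0) / 7 = m by omega]
    exact ⟨rfl, rfl⟩
  have core1 : ∀ m, m + 1 < k →
      f (7 * m + 1) = 2 ∧ z (7 * m + 1) = m + 2 := by
    intro m hm
    simp only [hfd, hzd]
    rw [if_pos (by omega), if_pos (by omega), show (7 * m + 1) % 7 = 1 by omega,
      show (7 * m + 1) / 7 = m by omega]
    exact ⟨rfl, rfl⟩
  have core2 : ∀ m, m + 1 < k →
      f (7 * m + 2) = 4 ∧ z (7 * m + 2) = m + 1 := by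
    intro m hm
    simp only [hfd, hzd]
    rw [if_pos (by omega), if_pos (by omega), show (7 * m + 2) % 7 = 2 by omega,
      show (7 * m + 2) / 7 = m by omega]
    exact ⟨rfl, rfl⟩
  have core3 : ∀ m, m + 1 < k →
      f (7 * m + 3) = 3 ∧ z (7 * m + 3) = m + 1 := by
    intro m hm
    simp only [hfd, hzd]
    rw [if_pos (by omega), if_pos (by omega), show (7 * m + 3) % 7 = 3 by omega,
      show (7 * m + 3) / 7 = m by omega]
    exact ⟨rfl, rfl⟩
  have core4 : ∀ m, m + 1 < k →
      f (7 * m + 4) = 6 ∧ z (7 * m + 4) = m + 2 := by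
    intro m hm
    simp only [hfd, hzd]
    rw [if_pos (by omega), if_pos (by omega), show (7 * m + 4) % 7 = 4 by omega,
      show (7 * m + 4) / 7 = m by omega]
    exact ⟨rfl, rfl⟩
  have core5 : ∀ m, m + 1 < k →
      f (7 * m + 5) = 7 ∧ z (7 * m + 5) = m + 2 := by
    intro m hm
    simp only [hfd, hzd]
    rw [if_pos (by omega), if_pos (by omega), show (7 * m + 5) % 7 = 5 by omega,
      show (7 * m + 5) / 7 = m by omega]
    exact ⟨rfl, rfl⟩
  have core6 : ∀ m, m + 1 < k →
      f (7 * m + 6) = 5 ∧ z (7 * m + 6) = m + 1 := by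
    intro m hm
    simp only [hfd, hzd]
    rw [if_pos (by omega), if_pos (by omega), show (7 * m + 6) % 7 = 6 by omega,
      show (7 * m + 6) / 7 = m by omega]
    exact ⟨rfl, rfl⟩
  have tail0 : f (7 * k - 7) = 5 ∧ z (7 * k - 7) = 0 := by
    simp only [hfd, hzd]
    exact ⟨by rw [if_neg (by omega), if_pos trivial], by rw [if_neg (by omega), if_pos trivial]⟩
  have run : ∀ m, m + 1 < k → f (7 * k - 6 + m) = 0 ∧ z (7 * k - 6 + m) = m + 1 := by
    intro m hm
    simp only [hfd, hzd]
    constructor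
    · rw [if_neg (by omega), if_neg (by omega), if_pos (by omega)]
    · rw [if_neg (by omega), if_neg (by omega), if_pos (by omega)]
      omega
  have tail2 : f (8 * k - 7) = 4 ∧ z (8 * k - 7) = 0 := by
    simp only [hfd, hzd]
    constructor <;>
    · rw [if_neg (by omega), if_neg (by omega), if_neg (by omega),
        show 8 * k - 7 - (8 * k - 7) = 0 by omega]
      rfl
  have tail3 : f (8 * k - 6) = 3 ∧ z (8 * k - 6) = 0 := by
    simp only [hfd, hzd]
    constructor <;>
    · rw [if_neg (by omega), if_neg (by omega), if_neg (by omega),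
        show 8 * k - 6 - (8 * k - 7) = 1 by omega]
      rfl
  have tail4 : f (8 * k - 5) = 7 ∧ z (8 * k - 5) = 1 := by
    simp only [hfd, hzd]
    constructor <;>
    · rw [if_neg (by omega), if_neg (by omega), if_neg (by omega),
        show 8 * k - 5 - (8 * k - 7) = 2 by omega]
      rfl
  have tail5 : f (8 * k - 4) = 6 ∧ z (8 * k - 4) = 1 := by
    simp only [hfd, hzd]
    constructor <;>
    · rw [if_neg (by omega), if_neg (by omega), if_neg (by omega),
        show 8 * k - 4 - (8 * k - 7) = 3 by omega]
      rfl
  have tail6 : f (8 * k - 3) = 0 ∧ z (8 * k - 3) = 0 := by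
    simp only [hfd, hzd]
    constructor <;>
    · rw [if_neg (by omega), if_neg (by omega), if_neg (by omega),
        show 8 * k - 3 - (8 * k - 7) = 4 by omega]
      rfl
  have tail7 : f (8 * k - 2) = 2 ∧ z (8 * k - 2) = 1 := by
    simp only [hfd, hzd]
    constructor <;>
    · rw [if_neg (by omega), if_neg (by omega), if_neg (by omega),
        show 8 * k - 2 - (8 * k - 7) = 5 by omega]
      rfl
  have tail8 : f (8 * k - 1) = 1 ∧ z (8 * k - 1) = 0 := by
    simp only [hfd, hzd]
    constructor <;>
    · rw [if_neg (by omega), if_neg (by omega), if_neg (by omega),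
        show 8 * k - 1 - (8 * k - 7) = 6 by omega]
      rfl
  refine cyclicallyHarmonious_of_codes hc hk hkt hgen hcard f z ?_ ?_ ?_
  · intro j
    simp only [hfd]
    split_ifs
    · exact getD_lt (by decide) (by decide) _
    · decide
    · decide
    · exact getD_lt (by decide) (by decide) _
  · clear hfd hzd
    intro a ha
    norm_num at ha
    interval_cases a
    · refine ⟨0, fun y h1 h2 => ?_⟩
      by_cases hy6 : y = 0
      · exact ⟨8 * k - 3, by omega, tail6.1, by omega⟩
      have h3 := run (y - 1).toNat (by omega)
      exact ⟨7 * k - 6 + (y - 1).toNat, by omega, h3.1, by omega⟩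
    · refine ⟨0, fun y h1 h2 => ?_⟩
      by_cases hy : y = 0
      · exact ⟨8 * k - 1, by omega, tail8.1, by omega⟩
      have h3 := core0 (y - 1).toNat (by omega)
      exact ⟨7 * (y - 1).toNat + 0, by omega, h3.1, by omega⟩
    · refine ⟨1, fun y h1 h2 => ?_⟩
      by_cases hy : y = 1
      · exact ⟨8 * k - 2, by omega, tail7.1, by omega⟩
      have h3 := core1 (y - 2).toNat (by omega)
      exact ⟨7 * (y - 2).toNat + 1, by omega, h3.1, by omega⟩
    · refine ⟨0, fun y h1 h2 => ?_⟩
      by_cases hy : y = 0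
      · exact ⟨8 * k - 6, by omega, tail3.1, by omega⟩
      have h3 := core3 (y - 1).toNat (by omega)
      exact ⟨7 * (y - 1).toNat + 3, by omega, h3.1, by omega⟩
    · refine ⟨0, fun y h1 h2 => ?_⟩
      by_cases hy : y = 0
      · exact ⟨8 * k - 7, by omega, tail2.1, by omega⟩
      have h3 := core2 (y - 1).toNat (by omega)
      exact ⟨7 * (y - 1).toNat + 2, by omega, h3.1, by omega⟩
    · refine ⟨0, fun y h1 h2 => ?_⟩
      by_cases hy : y = 0
      · exact ⟨7 * k - 7, by omega, tail0.1, by omega⟩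
      have h3 := core6 (y - 1).toNat (by omega)
      exact ⟨7 * (y - 1).toNat + 6, by omega, h3.1, by omega⟩
    · refine ⟨1, fun y h1 h2 => ?_⟩
      by_cases hy : y = 1
      · exact ⟨8 * k - 4, by omega, tail5.1, by omega⟩
      have h3 := core4 (y - 2).toNat (by omega)
      exact ⟨7 * (y - 2).toNat + 4, by omega, h3.1, by omega⟩
    · refine ⟨1, fun y h1 h2 => ?_⟩
      by_cases hy : y = 1
      · exact ⟨8 * k - 5, by omega, tail4.1, by omega⟩
      have h3 := core5 (y - 2).toNat (by omega)
      exact ⟨7 * (y - 2).toNat + 5, by omega, h3.1, by omega⟩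
  · clear hfd hzd
    intro a ha
    norm_num at ha
    interval_cases a
    · refine ⟨-1, 1, fun y h1 h2 => ?_⟩
      by_cases hy0 : y = -1
      · have h3 := core6 (k - 2) (by omega)
        have h4 := tail0
        refine ⟨7 * (k - 2) + 6, by omega, 7 * k - 7, by omega, ?_, by omega⟩
        rw [h3.1, h4.1]
        rfl
      by_cases hy1 : y = 0
      · have h3 := tail8
        have h4 := core0 0 (by omega)
        refine ⟨8 * k - 1, by omega, 7 * 0 + 0, by omega, ?_, by omega⟩
        rw [h3.1, h4.1]
        rfl
      have h3 := run (y - 1).toNat (by omega)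
      have h4 := run ((y - 1).toNat + 1) (by omega)
      refine ⟨7 * k - 6 + (y - 1).toNat, by omega, 7 * k - 6 + ((y - 1).toNat + 1), by omega, ?_,
        by omega⟩
      rw [h3.1, h4.1]
      rfl
    · refine ⟨0, 2, fun y h1 h2 => ?_⟩
      by_cases hy0 : y = 0
      · have h3 := tail4
        have h4 := tail5
        refine ⟨8 * k - 5, by omega, 8 * k - 4, by omega, ?_, by omega⟩
        rw [h3.1, h4.1]
        rfl
      have h3 := core4 (y - 1).toNat (by omega)
      have h4 := core5 (y - 1).toNat (by omega)
      refine ⟨7 * (y - 1).toNat + 4, by omega, 7 * (y - 1).toNat + 5, by omega, ?_, by omega⟩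
      rw [h3.1, h4.1]
      rfl
    · refine ⟨0, 1, fun y h1 h2 => ?_⟩
      by_cases hy0 : y = 0
      · have h3 := tail6
        have h4 := tail7
        refine ⟨8 * k - 3, by omega, 8 * k - 2, by omega, ?_, by omega⟩
        rw [h3.1, h4.1]
        rfl
      have h3 := core5 (y - 1).toNat (by omega)
      have h4 := core6 (y - 1).toNat (by omega)
      refine ⟨7 * (y - 1).toNat + 5, by omega, 7 * (y - 1).toNat + 6, by omega, ?_, by omega⟩
      rw [h3.1, h4.1]
      rfl
    · refine ⟨0, 1, fun y h1 h2 => ?_⟩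
      by_cases hy0 : y = 0
      · have h3 := tail7
        have h4 := tail8
        refine ⟨8 * k - 2, by omega, 8 * k - 1, by omega, ?_, by omega⟩
        rw [h3.1, h4.1]
        rfl
      have h3 := core0 (y - 1).toNat (by omega)
      have h4 := core1 (y - 1).toNat (by omega)
      refine ⟨7 * (y - 1).toNat + 0, by omega, 7 * (y - 1).toNat + 1, by omega, ?_, by omega⟩
      rw [h3.1, h4.1]
      rfl
    · refine ⟨-1, 1, fun y h1 h2 => ?_⟩
      by_cases hy0 : y = -1
      · have h3 := run (k - 2) (by omega)
        have h4 := tail2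
        refine ⟨7 * k - 6 + (k - 2), by omega, 8 * k - 7, by omega, ?_, by omega⟩
        rw [h3.1, h4.1]
        rfl
      by_cases hy1 : y = 0
      · have h3 := tail3
        have h4 := tail4
        refine ⟨8 * k - 6, by omega, 8 * k - 5, by omega, ?_, by omega⟩
        rw [h3.1, h4.1]
        rfl
      have h3 := core6 (y - 1).toNat (by omega)
      have h4 := core0 ((y - 1).toNat + 1) (by omega)
      refine ⟨7 * (y - 1).toNat + 6, by omega, 7 * ((y - 1).toNat + 1) + 0, by omega, ?_, by omega⟩
      rw [h3.1, h4.1]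
      rfl
    · refine ⟨0, 1, fun y h1 h2 => ?_⟩
      by_cases hy0 : y = 0
      · have h3 := tail0
        have h4 := run 0 (by omega)
        refine ⟨7 * k - 7, by omega, 7 * k - 6 + 0, by omega, ?_, by omega⟩
        rw [h3.1, h4.1]
        rfl
      have h3 := core3 (y - 1).toNat (by omega)
      have h4 := core4 (y - 1).toNat (by omega)
      refine ⟨7 * (y - 1).toNat + 3, by omega, 7 * (y - 1).toNat + 4, by omega, ?_, by omega⟩
      rw [h3.1, h4.1]
      rfl
    · refine ⟨0, 1, fun y h1 h2 => ?_⟩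
      by_cases hy0 : y = 0
      · have h3 := tail5
        have h4 := tail6
        refine ⟨8 * k - 4, by omega, 8 * k - 3, by omega, ?_, by omega⟩
        rw [h3.1, h4.1]
        rfl
      have h3 := core1 (y - 1).toNat (by omega)
      have h4 := core2 (y - 1).toNat (by omega)
      refine ⟨7 * (y - 1).toNat + 1, by omega, 7 * (y - 1).toNat + 2, by omega, ?_, by omega⟩
      rw [h3.1, h4.1]
      rfl
    · refine ⟨0, 0, fun y h1 h2 => ?_⟩
      by_cases hy0 : y = 0
      · have h3 := tail2
        have h4 := tail3
        refine ⟨8 * k - 7, by omega, 8 * k - 6, by omega, ?_, by omega⟩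
        rw [h3.1, h4.1]
        rfl
      have h3 := core2 (y - 1).toNat (by omega)
      have h4 := core3 (y - 1).toNat (by omega)
      refine ⟨7 * (y - 1).toNat + 2, by omega, 7 * (y - 1).toNat + 3, by omega, ?_, by omega⟩
      rw [h3.1, h4.1]
      rfl

/-! ### Kernel and image of doubling -/

/-- The subgroup of the elements `x` with `2 x = 0`. -/
def twoTorsion (G : Type*) [AddCommGroup G] : AddSubgroup G := (nsmulAddMonoidHom 2).ker

/-- The subgroup of the elements `2 x`. -/
def twoMultiples (G : Type*) [AddCommGroup G] : AddSubgroup G := (nsmulAddMonoidHom 2).range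

theorem mem_twoTorsion {G : Type*} [AddCommGroup G] {x : G} : x ∈ twoTorsion G ↔ 2 • x = 0 :=
  Iff.rfl

theorem card_twoTorsion_mul_card_twoMultiples (G : Type*) [AddCommGroup G] :
    Nat.card (twoTorsion G) * Nat.card (twoMultiples G) = Nat.card G := by
  rw [twoMultiples, ← AddSubgroup.index_ker]
  exact AddSubgroup.card_mul_index _

theorem even_card_of_two_nsmul {G : Type*} [AddCommGroup G] {x : G} (hx : 2 • x = 0)
    (hx0 : x ≠ 0) : Even (Nat.card G) := by
  rw [even_iff_two_dvd, ← addOrderOf_eq_prime hx hx0]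
  exact addOrderOf_dvd_natCard x

/-- By Cauchy, a prime dividing the order is the order of an element killed by `2`, hence it is `2`.
-/
theorem exists_card_twoTorsion (G : Type*) [AddCommGroup G] [Finite G] :
    ∃ j, Nat.card (twoTorsion G) = 2 ^ j := by
  refine ⟨_, Nat.eq_prime_pow_of_unique_prime_dvd Nat.card_pos.ne' fun {p} hp hdvd => ?_⟩
  have := Fact.mk hp
  obtain ⟨x, hx⟩ := exists_prime_addOrderOf_dvd_card' p hdvd
  have h : 2 • x = 0 := Subtype.ext x.2
  have := addOrderOf_dvd_of_nsmul_eq_zero h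
  rw [hx] at this
  exact (Nat.prime_dvd_prime_iff_eq hp Nat.prime_two).1 this

/-- A finite abelian 2-group with at most one involution is cyclic. -/
theorem isAddCyclic_of_involution_unique :
    ∀ (n : ℕ) (A : Type*) [AddCommGroup A] [Finite A], Nat.card A = 2 ^ n →
      (∀ x y : A, 2 • x = 0 → 2 • y = 0 → x ≠ 0 → y ≠ 0 → x = y) → IsAddCyclic A := by
  intro n
  induction n using Nat.strong_induction_on with
  | _ n ih =>
  intro A _ _ hA hinv
  have hT : Nat.card (twoTorsion A) ≤ 2 := by
    by_cases h : ∃ x : A, 2 • x = 0 ∧ x ≠ 0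
    · obtain ⟨x, hx, hx0⟩ := h
      have hsub : ((twoTorsion A : AddSubgroup A) : Set A) ⊆ {0, x} := fun y hy => by
        by_cases hy0 : y = 0
        · exact Or.inl hy0
        · exact Or.inr (hinv y x hy hx hy0 hx0)
      calc Nat.card (twoTorsion A) = ((twoTorsion A : AddSubgroup A) : Set A).ncard := rfl
        _ ≤ ({0, x} : Set A).ncard := Set.ncard_le_ncard hsub (Set.toFinite _)
        _ ≤ 2 := by simpa using Set.ncard_insert_le (0 : A) {x}
    · push Not at h
      have hbot : twoTorsion A = ⊥ := (AddSubgroup.eq_bot_iff_forall _).2 h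
      rw [hbot, AddSubgroup.card_bot]
      norm_num
  have hcard := card_twoTorsion_mul_card_twoMultiples A
  by_cases h1 : Nat.card (twoMultiples A) = 1
  · rw [h1, mul_one] at hcard
    have : Nat.card A = 1 ∨ Nat.card A = 2 := by
      have := Nat.card_pos (α := A)
      omega
    rcases this with h | h
    · have := (Nat.card_eq_one_iff_unique.1 h).1
      exact isAddCyclic_of_subsingleton
    · have := Fact.mk Nat.prime_two
      exact isAddCyclic_of_prime_card h
  · have hdvd : Nat.card (twoMultiples A) ∣ 2 ^ n := hA ▸ AddSubgroup.card_addSubgroup_dvd_card _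
    obtain ⟨i, hi, hi'⟩ := (Nat.dvd_prime_pow Nat.prime_two).1 hdvd
    have hi0 : i ≠ 0 := by
      rintro rfl
      exact h1 hi'
    have htwo : (∃ x : A, 2 • x = 0 ∧ x ≠ 0) := by
      have := Fact.mk Nat.prime_two
      obtain ⟨x, hx⟩ := exists_prime_addOrderOf_dvd_card' (G := A) 2 (by
        rw [← hcard, hi']
        exact dvd_mul_of_dvd_right (dvd_pow_self 2 hi0) _)
      refine ⟨x, hx ▸ addOrderOf_nsmul_eq_zero x, ?_⟩
      rintro rfl
      simp at hx
    have hlt : i < n := by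
      refine lt_of_le_of_ne hi ?_
      rintro rfl
      obtain ⟨x, hx, hx0⟩ := htwo
      have : Nat.card (twoTorsion A) = 1 := by
        rw [hi', hA] at hcard
        exact Nat.eq_of_mul_eq_mul_right (by positivity) (hcard.trans (one_mul _).symm)
      have := (Nat.card_eq_one_iff_unique.1 this).1
      exact hx0 (congrArg Subtype.val
        (Subsingleton.elim (⟨x, hx⟩ : twoTorsion A) ⟨0, smul_zero _⟩))
    -- By induction the doubles are cyclic, generated by some `2 t`. Since `2 t` has even order, `t`
    -- has order twice as large; the kernel of doubling has at most two elements, so this is at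
    -- least the order of `A`.
    obtain ⟨⟨s, hs⟩, hgen⟩ := (ih i hlt (twoMultiples A) hi' (fun x y hx hy hx0 hy0 =>
      Subtype.ext (hinv x y (congrArg Subtype.val hx) (congrArg Subtype.val hy)
        (fun h => hx0 (Subtype.ext h)) (fun h => hy0 (Subtype.ext h))))).exists_generator
    obtain ⟨t, rfl⟩ := hs
    have hord : addOrderOf (2 • t) = 2 ^ i := by
      rw [← hi', ← addOrderOf_eq_card_of_forall_mem_zmultiples hgen]
      exact (AddSubgroup.addOrderOf_mk _ _).symm
    have h2 : 2 ∣ addOrderOf t := by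
      refine dvd_trans ?_ (addOrderOf_dvd_of_mem_zmultiples (AddSubgroup.nsmul_mem _
        (AddSubgroup.mem_zmultiples t) 2))
      rw [hord]
      exact dvd_pow_self 2 hi0
    have h3 : addOrderOf t = 2 * 2 ^ i := by
      rw [addOrderOf_nsmul' t two_ne_zero, Nat.gcd_eq_right h2] at hord
      rw [← hord, Nat.mul_div_cancel' h2]
    refine isAddCyclic_of_addOrderOf_eq_card t (le_antisymm
      (Nat.le_of_dvd Nat.card_pos (addOrderOf_dvd_natCard t)) ?_)
    rw [h3, ← hcard, hi']
    exact Nat.mul_le_mul_right _ hT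

/-! ### Independent elements of an elementary abelian 2-group -/

theorem digitSum_congr {G : Type*} [AddCommGroup G] {w w' : ℕ → G} {j : ℕ}
    (h : ∀ i < j, w i = w' i) (a : ℕ) : digitSum w j a = digitSum w' j a := by
  induction j with
  | zero => rfl
  | succ j ih =>
    rw [digitSum, digitSum, ih fun i hi => h i (by omega), h j (by omega)]

theorem digitSum_mem {G : Type*} [AddCommGroup G] {w : ℕ → G} {T : AddSubgroup G}
    (hw : ∀ i, w i ∈ T) (j a : ℕ) : digitSum w j a ∈ T := by
  induction j with
  | zero => exact T.zero_mem
  | succ j ih =>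
    rw [digitSum]
    split_ifs
    · exact T.add_mem ih (hw j)
    · exact T.add_mem ih T.zero_mem

theorem digitSum_mod {G : Type*} [AddCommGroup G] (w : ℕ → G) {i j : ℕ} (hij : i ≤ j) (a : ℕ) :
    digitSum w i (a % 2 ^ j) = digitSum w i a := by
  induction i with
  | zero => rfl
  | succ i ih =>
    rw [digitSum, digitSum, ih (by omega), Nat.testBit_mod_two_pow]
    simp [show i < j by omega]

theorem digitSum_one {G : Type*} [AddCommGroup G] (w : ℕ → G) (j : ℕ) :
    digitSum w (j + 1) 1 = w 0 := by
  induction j with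
  | zero => simp [digitSum]
  | succ j ih =>
    rw [digitSum, ih]
    simp [Nat.testBit_succ]

/-- Linearly independent elements of an elementary abelian 2-group `T`, the first of them
prescribed, whose span avoids `Z`. -/
theorem exists_independent {G : Type*} [AddCommGroup G] {T : AddSubgroup G} (hT : ∀ x ∈ T, x + x = 0)
    {Z : Finset G} {d : G} (hd : d ∈ T) (hd0 : d ≠ 0) (hdZ : d ∉ Z) (h0 : 0 ∉ Z) (j : ℕ)
    (hj : (Z.card + 1) * 2 ^ j < Nat.card T) :
    ∃ w : ℕ → G, w 0 = d ∧ (∀ i, w i ∈ T) ∧ (∀ i < j + 1, ∀ a, digitSum w i a ≠ w i) ∧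
      ∀ a, digitSum w (j + 1) a ∉ Z := by
  classical
  induction j with
  | zero =>
    refine ⟨fun _ => d, rfl, fun _ => hd, fun i hi a => ?_, fun a => ?_⟩
    · obtain rfl : i = 0 := by omega
      exact hd0.symm
    · simp only [digitSum, zero_add]
      split_ifs
      exacts [hdZ, h0]
  | succ j ih =>
    obtain ⟨w, hw0, hwT, hind, hZ⟩ := ih (lt_of_le_of_lt
      (Nat.mul_le_mul_left _ (Nat.pow_le_pow_right (by norm_num) (Nat.le_succ j))) hj)
    -- Forbidden choices for the next element: the current span, and its translates by `Z`, which
    -- would bring `Z` into the new span. The bound on the order of `T` leaves an element outside.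
    set B : Finset G := (insert 0 Z ×ˢ Finset.range (2 ^ (j + 1))).image
      (fun p => p.1 + digitSum w (j + 1) p.2) with hB
    have hBcard : (B : Set G).ncard < (T : Set G).ncard := by
      rw [Set.ncard_coe_finset]
      refine lt_of_le_of_lt ?_ hj
      refine Finset.card_image_le.trans ?_
      rw [Finset.card_product, Finset.card_range]
      exact Nat.mul_le_mul_right _ (Finset.card_insert_le _ _)
    obtain ⟨v, hvT, hvB⟩ := Set.exists_mem_notMem_of_ncard_lt_ncard hBcard B.finite_toSet
    have hv : ∀ z ∈ insert 0 Z, ∀ a, z + digitSum w (j + 1) a ≠ v := by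
      intro z hz a hza
      refine hvB ?_
      rw [Finset.mem_coe, hB, Finset.mem_image]
      refine ⟨(z, a % 2 ^ (j + 1)), Finset.mem_product.2 ⟨hz, Finset.mem_range.2
        (Nat.mod_lt _ (by positivity))⟩, ?_⟩
      rw [← hza, digitSum_mod w le_rfl]
    have hupd : ∀ i ≤ j + 1, ∀ a,
        digitSum (Function.update w (j + 1) v) i a = digitSum w i a := fun i hi a =>
      digitSum_congr (fun l hl => Function.update_of_ne (show l ≠ j + 1 by omega) v w) a
    refine ⟨Function.update w (j + 1) v, ?_, ?_, ?_, ?_⟩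
    · rw [Function.update_of_ne (by omega), hw0]
    · intro i
      rcases eq_or_ne i (j + 1) with rfl | hi
      · rw [Function.update_self]
        exact hvT
      · rw [Function.update_of_ne hi]
        exact hwT i
    · intro i hi a
      rw [hupd i (by omega)]
      rcases eq_or_ne i (j + 1) with rfl | hi'
      · rw [Function.update_self]
        simpa using hv 0 (Finset.mem_insert_self _ _) a
      · rw [Function.update_of_ne hi']
        exact hind i (by omega) a
    · intro a ha
      rw [digitSum, hupd _ le_rfl, Function.update_self] at ha
      split_ifs at ha
      · refine hv _ (Finset.mem_insert_of_mem ha) a ?_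
        rw [add_right_comm, hT _ (digitSum_mem hwT _ _), zero_add]
      · rw [add_zero] at ha
        exact hZ a ha

/-- An elementary abelian 2-group of order `2 ^ (j + 1)` is the set of all digit sums of suitable
elements, the first of them prescribed. -/
theorem exists_coding {G : Type*} [AddCommGroup G] [Finite G] {T : AddSubgroup G}
    (hT : ∀ x ∈ T, x + x = 0) {d : G} (hd : d ∈ T) (hd0 : d ≠ 0) {j : ℕ}
    (hj : Nat.card T = 2 ^ (j + 1)) :
    ∃ (c : ℕ → G) (hc : IsCoding (2 ^ (j + 1)) (· ^^^ ·) c), c 1 = d ∧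
      codedSubgroup (isTable_xor (j + 1)) hc = T := by
  obtain ⟨w, hw0, hwT, hind, -⟩ := exists_independent hT (Z := ∅) hd hd0 (by simp) (by simp) j
    (by rw [hj, pow_succ]; simp)
  have hc := isCoding_digitSum (fun i => hT _ (hwT i)) (j + 1) hind
  refine ⟨digitSum w (j + 1), hc, (digitSum_one w j).trans hw0, ?_⟩
  · refine AddSubgroup.eq_of_le_of_card_ge ?_ ?_
    · rintro _ ⟨a, -, rfl⟩
      exact digitSum_mem hwT _ _
    · rw [card_codedSubgroup, hj]

/-! ### Odd order, and the hypothesis for even order -/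

theorem cyclicallyHarmonious_of_card_one {G : Type*} [AddCommGroup G] (h : Nat.card G = 1) :
    CyclicallyHarmonious G :=
  ⟨fun _ => 0, fun i hi j hj _ => by omega, fun i hi j hj _ => by omega⟩

theorem card_quotient_lt {G : Type*} [AddCommGroup G] [Finite G] {K : AddSubgroup G} {x : G}
    (hx : x ∈ K) (hx0 : x ≠ 0) : Nat.card (G ⧸ K) < Nat.card G := by
  rw [K.card_eq_card_quotient_mul_card_addSubgroup]
  refine lt_mul_of_one_lt_right Nat.card_pos ?_
  have : Nontrivial K := ⟨⟨x, hx⟩, 0, fun h => hx0 (congrArg Subtype.val h)⟩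
  exact Finite.one_lt_card

theorem cyclicallyHarmonious_of_odd_card (n : ℕ) : ∀ (G : Type*) [AddCommGroup G] [Finite G],
    Nat.card G = n → Odd n → CyclicallyHarmonious G := by
  induction n using Nat.strong_induction_on with
  | _ n ih =>
  intro G _ _ hG hn
  by_cases h1 : Nat.card G = 1
  · exact cyclicallyHarmonious_of_card_one h1
  obtain ⟨p, hp, hdvd⟩ := Nat.exists_prime_and_dvd h1
  have := Fact.mk hp
  obtain ⟨g, hg⟩ := exists_prime_addOrderOf_dvd_card' p hdvd
  have hg0 : g ≠ 0 := by
    rintro rfl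
    simp only [addOrderOf_zero] at hg
    exact hp.one_lt.ne hg
  have hodd : ∀ m, m ∣ Nat.card G → Odd m := fun m hm => Odd.of_dvd_nat (hG ▸ hn) hm
  refine cyclicallyHarmonious_of_odd_element g (hodd _ (addOrderOf_dvd_natCard g))
    (ih _ (hG ▸ card_quotient_lt (AddSubgroup.mem_zmultiples g) hg0) _ rfl (hodd _ ?_))
  exact ⟨_, AddSubgroup.card_eq_card_quotient_mul_card_addSubgroup _⟩

/-- The condition on a finite abelian group of even order: two involutions and an element whose
double does not vanish. -/
def RichTwoTorsion (G : Type*) [AddCommGroup G] : Prop :=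
  (∃ e f : G, 2 • e = 0 ∧ 2 • f = 0 ∧ e ≠ 0 ∧ f ≠ 0 ∧ e ≠ f) ∧ ∃ x : G, 2 • x ≠ 0

theorem RichTwoTorsion.even_card {G : Type*} [AddCommGroup G] (h : RichTwoTorsion G) :
    Even (Nat.card G) := by
  obtain ⟨⟨e, -, he, -, he0, -⟩, -⟩ := h
  exact even_card_of_two_nsmul he he0

theorem mem_zmultiples_of_two_nsmul {G : Type*} [AddCommGroup G] {g x : G}
    (hg : Odd (addOrderOf g)) (hx : 2 • x = 0) (h : x ∈ AddSubgroup.zmultiples g) : x = 0 := by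
  have h1 : addOrderOf x ∣ 2 := addOrderOf_dvd_of_nsmul_eq_zero hx
  have h2 : Odd (addOrderOf x) := Odd.of_dvd_nat hg (addOrderOf_dvd_of_mem_zmultiples h)
  rw [← AddMonoid.addOrderOf_eq_one_iff]
  rcases (Nat.dvd_prime Nat.prime_two).1 h1 with h | h
  · exact h
  · rw [h] at h2
    exact absurd h2 (by decide)

/-- Passing to the quotient by an element of odd order. -/
theorem RichTwoTorsion.quotient_of_odd {G : Type*} [AddCommGroup G] (h : RichTwoTorsion G) {g : G}
    (hg : Odd (addOrderOf g)) {x : G} (hx : 2 • x ∉ AddSubgroup.zmultiples g) :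
    RichTwoTorsion (G ⧸ AddSubgroup.zmultiples g) := by
  obtain ⟨⟨e, f, he, hf, he0, hf0, hef⟩, -⟩ := h
  have key : ∀ y : G, 2 • y = 0 → y ≠ 0 → (y : G ⧸ AddSubgroup.zmultiples g) ≠ 0 :=
    fun y hy hy0 h => hy0 (mem_zmultiples_of_two_nsmul hg hy
      ((QuotientAddGroup.eq_zero_iff y).1 h))
  refine ⟨⟨e, f, ?_, ?_, key e he he0, key f hf hf0, fun h => ?_⟩, x, ?_⟩
  · rw [← QuotientAddGroup.mk_nsmul, he]
    rfl
  · rw [← QuotientAddGroup.mk_nsmul, hf]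
    rfl
  · refine key (e - f) (by rw [smul_sub, he, hf, sub_zero]) (sub_ne_zero.2 hef) ?_
    rw [QuotientAddGroup.mk_sub, h, sub_self]
  · rw [← QuotientAddGroup.mk_nsmul]
    exact fun h => hx ((QuotientAddGroup.eq_zero_iff _).1 h)

theorem RichTwoTorsion.two_lt_card {G : Type*} [AddCommGroup G] [Finite G]
    (h : RichTwoTorsion G) : 2 < Nat.card (twoTorsion G) := by
  obtain ⟨⟨e, f, he, hf, he0, hf0, hef⟩, -⟩ := h
  have hsub : ({0, e, f} : Set G) ⊆ twoTorsion G := by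
    rintro x (rfl | rfl | rfl)
    exacts [smul_zero _, he, hf]
  have h3 : ({0, e, f} : Set G).ncard = 3 :=
    Set.ncard_eq_three.2 ⟨0, e, f, he0.symm, hf0.symm, hef, rfl⟩
  exact lt_of_lt_of_le (by rw [h3]; norm_num) (Set.ncard_le_ncard hsub (Set.toFinite _))

/-- At least three elements of order dividing two yield two involutions. -/
theorem exists_two_involutions {G : Type*} [AddCommGroup G] [Finite G]
    (h : 2 < Nat.card (twoTorsion G)) :
    ∃ e f : G, 2 • e = 0 ∧ 2 • f = 0 ∧ e ≠ 0 ∧ f ≠ 0 ∧ e ≠ f := by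
  obtain ⟨e, heT, he0⟩ := Set.exists_mem_notMem_of_ncard_lt_ncard (s := ({0} : Set G))
    (t := twoTorsion G) (by rw [Set.ncard_singleton]; exact lt_trans (by norm_num) h)
  obtain ⟨f, hfT, hf0⟩ := Set.exists_mem_notMem_of_ncard_lt_ncard (s := ({0, e} : Set G))
    (t := twoTorsion G) (lt_of_le_of_lt ((Set.ncard_insert_le _ _).trans (by simp)) h)
  simp only [Set.mem_insert_iff, Set.mem_singleton_iff, not_or] at he0 hf0
  exact ⟨e, f, heT, hfT, he0, hf0.1, fun h => hf0.2 h.symm⟩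

/-- The kernel of `T → G/K` embeds into `K`. -/
theorem card_le_card_mul_card_map {G : Type*} [AddCommGroup G] [Finite G] (K T : AddSubgroup G) :
    Nat.card T ≤ Nat.card K * Nat.card (T.map (QuotientAddGroup.mk' K)) := by
  have h := ((QuotientAddGroup.mk' K).comp T.subtype).ker.card_mul_index
  rw [AddSubgroup.index_ker, AddMonoidHom.range_comp, AddSubgroup.range_subtype] at h
  rw [← h]
  refine Nat.mul_le_mul_right _ (Nat.card_le_card_of_injective
    (fun y => (⟨y.1, (QuotientAddGroup.eq_zero_iff _).1 y.2⟩ : K)) fun y z hyz => ?_)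
  exact Subtype.ext (Subtype.ext (Subtype.mk.inj hyz))

/-- There is room for a subgroup `K = (ℤ/2)⁴` of the 2-torsion that misses `2 x`, so a nonzero
double survives in the quotient. More than `32 / 16 = 2` classes of 2-torsion also survive, which
gives two involutions. -/
theorem cyclicallyHarmonious_of_large_twoTorsion {G : Type*} [AddCommGroup G] [Finite G]
    (hT : 32 < Nat.card (twoTorsion G)) {x : G} (hx : 2 • x ≠ 0)
    (ih : ∀ K : AddSubgroup G, Nat.card (G ⧸ K) < Nat.card G → RichTwoTorsion (G ⧸ K) →
      CyclicallyHarmonious (G ⧸ K)) : CyclicallyHarmonious G := by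
  have hadd : ∀ y ∈ twoTorsion G, y + y = 0 := fun y hy => by rw [← two_nsmul]; exact hy
  obtain ⟨d, hdT, hd⟩ := Set.exists_mem_notMem_of_ncard_lt_ncard (s := ({0, 2 • x} : Set G))
    (t := twoTorsion G) (lt_of_le_of_lt ((Set.ncard_insert_le _ _).trans (by simp))
      (lt_trans (show 2 < 32 by norm_num) hT))
  simp only [Set.mem_insert_iff, Set.mem_singleton_iff, not_or] at hd
  obtain ⟨w, -, hwT, hind, hZ⟩ := exists_independent hadd (Z := {2 • x}) hdT hd.1 (by simpa using
    hd.2) (by simpa using hx.symm) 3 (by simp; omega)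
  have hc := isCoding_digitSum (fun i => hadd _ (hwT i)) 4 hind
  have ht := isTable_xor 4
  set K := codedSubgroup ht hc with hK
  have hxK : 2 • x ∉ K := by
    rintro ⟨a, -, h⟩
    exact hZ a (by simpa using h)
  have hKcard : Nat.card K = 2 ^ 4 := card_codedSubgroup ht hc
  have hQT : 2 < Nat.card (twoTorsion (G ⧸ K)) := by
    have h1 := card_le_card_mul_card_map K (twoTorsion G)
    have h2 : Nat.card ((twoTorsion G).map (QuotientAddGroup.mk' K)) ≤
        Nat.card (twoTorsion (G ⧸ K)) := by
      refine AddSubgroup.card_le_of_le ?_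
      rintro _ ⟨y, hy, rfl⟩
      exact (map_nsmul (QuotientAddGroup.mk' K) 2 y).symm.trans
        (by rw [show 2 • y = 0 from hy, map_zero])
    rw [hKcard] at h1
    omega
  have hQ : RichTwoTorsion (G ⧸ K) := ⟨exists_two_involutions hQT, x, by
    rw [← QuotientAddGroup.mk_nsmul]
    exact fun h => hxK ((QuotientAddGroup.eq_zero_iff _).1 h)⟩
  refine evenListing_xor_four.cyclicallyHarmonious ht hc (ih K (card_quotient_lt (x := w 0) ?_ ?_)
    hQ) hQ.even_card
  · exact ⟨1, by norm_num, digitSum_one w 3⟩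
  · exact fun h => hind 0 (by norm_num) 0 (by simp [digitSum, h])

theorem cyclicallyHarmonious_of_coding_addTwoFour {G : Type*} [AddCommGroup G] {c : ℕ → G}
    (hc : IsCoding 8 addTwoFour c) (hG : Nat.card G = 8) : CyclicallyHarmonious G := by
  have hA : ∀ a < 8, listEntry [0, 1, 2, 4, 6, 3, 5, 7] a < 8 := by decide
  refine ⟨fun j => c (listEntry [0, 1, 2, 4, 6, 3, 5, 7] j), fun i hi j hj h => ?_,
    fun i hi j hj h => ?_⟩
  · rw [hG] at hi hj
    have key : ∀ i < 8, ∀ j < 8, listEntry [0, 1, 2, 4, 6, 3, 5, 7] i =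
      listEntry [0, 1, 2, 4, 6, 3, 5, 7] j → i = j := by decide
    exact key i hi j hj (hc.inj _ (hA i hi) _ (hA j hj) h)
  · rw [hG] at hi hj h
    have key : ∀ i < 8, ∀ j < 8, addTwoFour (listEntry [0, 1, 2, 4, 6, 3, 5, 7] i)
      (listEntry [0, 1, 2, 4, 6, 3, 5, 7] ((i + 1) % 8)) = addTwoFour
      (listEntry [0, 1, 2, 4, 6, 3, 5, 7] j) (listEntry [0, 1, 2, 4, 6, 3, 5, 7] ((j + 1) % 8)) →
      i = j := by decide
    exact key i hi j hj (hc.add_eq isTable_addTwoFour (hA i hi) (hA _ (Nat.mod_lt _ (by norm_num)))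
      (hA j hj) (hA _ (Nat.mod_lt _ (by norm_num))) h)

/-! ### Groups with cyclic doubles -/

/-- If the doubles `2 x` form the cyclic group generated by `2 t`, then every element is the sum
of an element of order dividing two and a multiple of `t`. -/
theorem exists_twoTorsion_add_zsmul {G : Type*} [AddCommGroup G] {t : G}
    (hgen : ∀ x : G, ∃ y : ℤ, 2 • x = y • (2 • t)) (x : G) :
    ∃ a ∈ twoTorsion G, ∃ y : ℤ, x = a + y • t := by
  obtain ⟨y, hy⟩ := hgen x
  refine ⟨x - y • t, ?_, y, by abel⟩
  rw [mem_twoTorsion, smul_sub, hy, smul_comm, sub_self]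

theorem card_eq_of_cyclic_doubles {G : Type*} [AddCommGroup G] {t : G}
    (hgen : ∀ x : G, ∃ y : ℤ, 2 • x = y • (2 • t)) :
    Nat.card G = Nat.card (twoTorsion G) * addOrderOf (2 • t) := by
  rw [← card_twoTorsion_mul_card_twoMultiples, ← Nat.card_zmultiples]
  congr 2
  have : twoMultiples G = AddSubgroup.zmultiples (2 • t) := by
    ext x
    constructor
    · rintro ⟨y, rfl⟩
      obtain ⟨z, hz⟩ := hgen y
      exact ⟨z, hz.symm⟩
    · rintro ⟨z, rfl⟩
      exact ⟨z • t, smul_comm _ _ _⟩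
  rw [this]

theorem nsmul_mem_twoTorsion {G : Type*} [AddCommGroup G] {t : G} (m : ℕ) :
    m • t ∈ twoTorsion G ↔ addOrderOf (2 • t) ∣ m := by
  rw [mem_twoTorsion, smul_comm, addOrderOf_dvd_iff_nsmul_eq_zero]

theorem add_self_of_mem_twoTorsion {G : Type*} [AddCommGroup G] :
    ∀ x ∈ twoTorsion G, x + x = 0 := fun x hx => by
  rw [← two_nsmul]
  exact hx

/-- The groups whose doubles form a cyclic group of odd order. -/
theorem cyclicallyHarmonious_of_cyclic_doubles_odd {G : Type*} [AddCommGroup G] [Finite G] {t : G}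
    (hgen : ∀ x : G, ∃ y : ℤ, 2 • x = y • (2 • t)) (hk : Odd (addOrderOf (2 • t)))
    (hk1 : 1 < addOrderOf (2 • t)) (hT : 2 < Nat.card (twoTorsion G))
    (hT' : Nat.card (twoTorsion G) ≤ 32) : CyclicallyHarmonious G := by
  have hcard := card_eq_of_cyclic_doubles hgen
  set k := addOrderOf (2 • t)
  obtain ⟨d, -, hd, -, hd0, -⟩ := exists_two_involutions hT
  obtain ⟨j, hj⟩ := exists_card_twoTorsion G
  rw [hj] at hT hT' hcard
  have hj1 : 1 < j := (Nat.pow_lt_pow_iff_right (a := 2) (by norm_num)).1 hT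
  have hj5 : j ≤ 5 := (Nat.pow_le_pow_iff_right (by norm_num)).1 hT'
  obtain ⟨i, rfl⟩ : ∃ i, j = i + 1 := ⟨j - 1, by omega⟩
  obtain ⟨c, hc, -, hcT⟩ := exists_coding add_self_of_mem_twoTorsion hd hd0 hj
  obtain ⟨s, hs⟩ := hk
  have hk' : Odd k := ⟨s, hs⟩
  -- Replaces `t` by an element with the same double but without a 2-torsion part: `s + 1` halves `2
  -- t` inside its own group of order `k = 2s + 1`.
  obtain ⟨t', ht', hkt'⟩ : ∃ t' : G, 2 • t' = 2 • t ∧ k • t' = 0 := by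
    have h0 : k • (2 • t) = 0 := addOrderOf_nsmul_eq_zero _
    refine ⟨(s + 1) • (2 • t), ?_, by rw [smul_comm, h0, smul_zero]⟩
    rw [← mul_nsmul', show 2 * (s + 1) = k + 1 by omega, add_nsmul, h0, zero_add, one_nsmul]
  have hgen' : ∀ g, ∃ a < 2 ^ (i + 1), ∃ y : ℤ, g = c a + y • t' := by
    intro g
    obtain ⟨a, ha, y, rfl⟩ := exists_twoTorsion_add_zsmul (ht' ▸ hgen) g
    rw [← hcT] at ha
    obtain ⟨b, hb, rfl⟩ := ha
    exact ⟨b, hb, y, rfl⟩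
  have hQcard : Nat.card (G ⧸ codedSubgroup (isTable_xor (i + 1)) hc) = k := by
    have h := AddSubgroup.card_eq_card_quotient_mul_card_addSubgroup
      (codedSubgroup (isTable_xor (i + 1)) hc)
    rw [card_codedSubgroup, hcard, mul_comm] at h
    exact (Nat.eq_of_mul_eq_mul_right (by positivity) h).symm
  have hQ := cyclicallyHarmonious_of_odd_card k (G ⧸ codedSubgroup (isTable_xor (i + 1)) hc)
    hQcard hk'
  obtain rfl | rfl | rfl | rfl : i = 1 ∨ i = 2 ∨ i = 3 ∨ i = 4 := by omega
  · exact cyclicallyHarmonious_of_coding_four hc hk' hk1 hkt' hgen' hcard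
  · exact cyclicallyHarmonious_of_coding_eight hc hk' hk1 hkt' hgen' hcard
  · exact oddListing_xor_four.cyclicallyHarmonious _ hc hQ (hQcard ▸ hk') (hQcard ▸ hk1)
  · exact oddListing_xor_five.cyclicallyHarmonious _ hc hQ (hQcard ▸ hk') (hQcard ▸ hk1)

/-- The 2-groups whose doubles form a non-trivial cyclic group. -/
theorem cyclicallyHarmonious_of_cyclic_doubles_even {G : Type*} [AddCommGroup G] [Finite G] {t : G}
    (hgen : ∀ x : G, ∃ y : ℤ, 2 • x = y • (2 • t)) {l : ℕ} (hk : addOrderOf (2 • t) = 2 ^ (l + 1))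
    (hT : 2 < Nat.card (twoTorsion G)) (hT' : Nat.card (twoTorsion G) ≤ 32) :
    CyclicallyHarmonious G := by
  have hcard := card_eq_of_cyclic_doubles hgen
  have hmem := fun m : ℕ => (nsmul_mem_twoTorsion (t := t) m).1
  have hd : (2 ^ (l + 1)) • t ∈ twoTorsion G := (nsmul_mem_twoTorsion _).2 hk.dvd
  rw [hk] at hcard hmem
  -- This involution is the value of `k t` for `k = 2 ^ (l + 1)`; being nonzero, it can be given the
  -- code `1`.
  have hd0 : (2 ^ (l + 1)) • t ≠ 0 := by
    intro h
    have h1 : 2 ^ l • (2 • t) = 0 := by rw [← mul_nsmul', ← pow_succ, h]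
    have h2 := addOrderOf_dvd_of_nsmul_eq_zero h1
    rw [hk] at h2
    exact absurd (Nat.le_of_dvd (by positivity) h2)
      (not_le.2 (Nat.pow_lt_pow_right (by norm_num) (Nat.lt_succ_self l)))
  obtain ⟨j, hj⟩ := exists_card_twoTorsion G
  rw [hj] at hT' hcard
  have hj1 : 1 < j := (Nat.pow_lt_pow_iff_right (a := 2) (by norm_num)).1 (hj ▸ hT)
  have hj5 : j ≤ 5 := (Nat.pow_le_pow_iff_right (by norm_num)).1 hT'
  obtain ⟨i, rfl⟩ : ∃ i, j = i + 1 := ⟨j - 1, by omega⟩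
  obtain ⟨c, hc, hc1, hcT⟩ := exists_coding add_self_of_mem_twoTorsion hd hd0 hj
  have heven : Even (2 ^ (l + 1)) := (Nat.even_pow.2 ⟨even_two, by omega⟩)
  have hpos : 0 < 2 ^ (l + 1) := by positivity
  have hmem' : ∀ m : ℕ, m • t ∈ codedSubgroup (isTable_xor (i + 1)) hc → 2 ^ (l + 1) ∣ m := by
    rw [hcT]
    exact hmem
  obtain rfl | rfl | rfl | rfl : i = 1 ∨ i = 2 ∨ i = 3 ∨ i = 4 := by omega
  -- For 2-torsion of order four, the subgroup used is the larger `ℤ/2 × ℤ/4` generated by an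
  -- involution `w` and `u = 2 ^ l t`. It is the whole group if `l = 0`; otherwise the quotient is
  -- cyclic, and `k t = u` has code `1`.
  · obtain ⟨w, hwT, hw⟩ := Set.exists_mem_notMem_of_ncard_lt_ncard
      (s := ({0, (2 ^ (l + 1)) • t} : Set G)) (t := twoTorsion G)
      (lt_of_le_of_lt ((Set.ncard_insert_le _ _).trans (by simp)) hT)
    simp only [Set.mem_insert_iff, Set.mem_singleton_iff, not_or] at hw
    have h2u : 2 • (2 ^ l • t) = (2 ^ (l + 1)) • t := by rw [← mul_nsmul', pow_succ']
    have hc := isCoding_addTwoFour (w := w) (u := 2 ^ l • t) hwT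
      (by rw [show 4 = 2 * 2 from rfl, mul_nsmul', h2u]; exact hd) hw.1 (by rwa [h2u])
      (by rw [h2u]; exact hw.2)
    rcases l with _ | l
    · exact cyclicallyHarmonious_of_coding_addTwoFour hc (by rw [hcard]; norm_num)
    · obtain ⟨p, q, p', q', H⟩ := exists_halfListing_addTwoFour 1 (by norm_num)
      refine H.cyclicallyHarmonious (k := 2 ^ (l + 1)) isTable_addTwoFour hc (by norm_num) t
        (Nat.even_pow.2 ⟨even_two, by omega⟩) (by positivity) (by simp) (fun m hm => ?_)
        (by rw [hcard]; ring)
      obtain ⟨a, -, ha⟩ := hm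
      -- Doubling removes the `w` component, so the comparison takes place among multiples of `2 t`,
      -- whose order is known.
      have h1 : m • (2 • t) = (a % 4 * 2 ^ (l + 1)) • (2 • t) := by
        rw [smul_comm m 2 t, ← ha]
        show 2 • ((a / 4) • w + (a % 4) • (2 ^ (l + 1) • t)) = _
        rw [smul_add, smul_comm 2 (a / 4) w, show 2 • w = 0 from hwT, smul_zero, zero_add,
          mul_nsmul', smul_comm 2 (a % 4), smul_comm 2 (2 ^ (l + 1)) t]
      have h2 := nsmul_eq_nsmul_iff_modEq.1 h1
      rw [hk] at h2
      have h3 := h2.of_dvd (pow_dvd_pow 2 (Nat.le_succ (l + 1)))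
      exact (h3.dvd_iff dvd_rfl).2 (dvd_mul_left _ _)
  · exact halfListing_xor_three.cyclicallyHarmonious (isTable_xor 3) hc (by norm_num) t heven hpos
      hc1.symm hmem' hcard
  · exact halfListing_xor_four.cyclicallyHarmonious (isTable_xor 4) hc (by norm_num) t heven hpos
      hc1.symm hmem' hcard
  · exact halfListing_xor_five.cyclicallyHarmonious (isTable_xor 5) hc (by norm_num) t heven hpos
      hc1.symm hmem' hcard

/-! ### 2-groups with noncyclic doubles -/

/-- Passing to the quotient by a subgroup `ℤ/2 × ℤ/4` of a 2-group. -/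
theorem cyclicallyHarmonious_of_quotient_addTwoFour {G : Type*} [AddCommGroup G] [Finite G]
    {c : ℕ → G} (hc : IsCoding 8 addTwoFour c) {n : ℕ} (hG : Nat.card G = 2 ^ n) (hG8 : Nat.card G ≠ 8)
    (h : (∃ x : G, 2 • x ∉ codedSubgroup isTable_addTwoFour hc) ∨
      Nat.card (G ⧸ codedSubgroup isTable_addTwoFour hc) ≤ 2)
    (ih : ∀ K : AddSubgroup G, Nat.card (G ⧸ K) < Nat.card G → RichTwoTorsion (G ⧸ K) →
      CyclicallyHarmonious (G ⧸ K)) : CyclicallyHarmonious G := by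
  set K := codedSubgroup isTable_addTwoFour hc with hK
  have hcard : Nat.card G = Nat.card (G ⧸ K) * 8 := by
    rw [K.card_eq_card_quotient_mul_card_addSubgroup, hK, card_codedSubgroup]
  obtain ⟨i, -, hi⟩ := (Nat.dvd_prime_pow Nat.prime_two).1
    (show Nat.card (G ⧸ K) ∣ 2 ^ n from hG ▸ ⟨8, hcard⟩)
  have hi0 : i ≠ 0 := by
    rintro rfl
    rw [hi] at hcard
    exact hG8 hcard
  have heven : Even (Nat.card (G ⧸ K)) := hi ▸ Nat.even_pow.2 ⟨even_two, hi0⟩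
  -- With at most one involution the quotient is cyclic and the half listings apply. Otherwise it
  -- has two involutions, and either alternative in `h` makes it rich: a double outside `K`
  -- survives, while order at most two leaves no room for two involutions.
  by_cases hinv : ∀ x y : G ⧸ K, 2 • x = 0 → 2 • y = 0 → x ≠ 0 → y ≠ 0 → x = y
  · obtain ⟨s, hs⟩ := (isAddCyclic_of_involution_unique i (G ⧸ K) hi hinv).exists_generator
    obtain ⟨t, rfl⟩ := QuotientAddGroup.mk_surjective s
    have hord : addOrderOf (t : G ⧸ K) = Nat.card (G ⧸ K) :=
      addOrderOf_eq_card_of_forall_mem_zmultiples hs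
    have hmem : ∀ m : ℕ, m • t ∈ K ↔ Nat.card (G ⧸ K) ∣ m := fun m => by
      rw [← hord, addOrderOf_dvd_iff_nsmul_eq_zero, ← QuotientAddGroup.mk_nsmul,
        QuotientAddGroup.eq_zero_iff]
    obtain ⟨d, hd, hdt⟩ := (hmem _).2 dvd_rfl
    obtain ⟨p, q, p', q', H⟩ := exists_halfListing_addTwoFour d hd
    exact H.cyclicallyHarmonious isTable_addTwoFour hc hd t heven Nat.card_pos hdt.symm
      (fun m => (hmem m).1) (by rw [hcard, mul_comm])
  · push Not at hinv
    obtain ⟨e, f, he, hf, he0, hf0, hef⟩ := hinv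
    have hrich : RichTwoTorsion (G ⧸ K) := by
      refine ⟨⟨e, f, he, hf, he0, hf0, hef⟩, ?_⟩
      rcases h with ⟨x, hx⟩ | h
      · refine ⟨x, fun h => hx ((QuotientAddGroup.eq_zero_iff _).1 ?_)⟩
        rwa [QuotientAddGroup.mk_nsmul]
      · have h3 : ({0, e, f} : Set (G ⧸ K)).ncard = 3 :=
          Set.ncard_eq_three.2 ⟨0, e, f, he0.symm, hf0.symm, hef, rfl⟩
        have h4 := Set.ncard_le_card ({0, e, f} : Set (G ⧸ K))
        omega
    have hu : c 1 ∈ K := ⟨1, by norm_num, rfl⟩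
    have hu0 : c 1 ≠ 0 := fun h => absurd
      (hc.inj 1 (by norm_num) 0 (by norm_num) (h.trans hc.zero.symm)) one_ne_zero
    exact evenListing_addTwoFour.cyclicallyHarmonious isTable_addTwoFour hc
      (ih K (card_quotient_lt hu hu0) hrich) heven

/-- Doubles inside `ℤ/2 × ℤ/4` are only `0` and `2 u`, decided by the parity of the code. -/
theorem two_nsmul_of_mem_addTwoFour {G : Type*} [AddCommGroup G] {w u : G} (hw : 2 • w = 0)
    (hu : 2 • (2 • u) = 0) (a : ℕ) :
    2 • ((a / 4) • w + (a % 4) • u) = (a % 2) • (2 • u) := by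
  rw [smul_add, smul_comm 2 (a / 4) w, hw, smul_zero, zero_add, smul_comm]
  conv_lhs => rw [← Nat.div_add_mod (a % 4) 2, add_nsmul, mul_nsmul, hu, smul_zero, zero_add,
    Nat.mod_mod_of_dvd a (by norm_num : 2 ∣ 4)]

theorem four_le_card {G : Type*} [AddCommGroup G] [Finite G] {S : AddSubgroup G} {i : ℕ}
    (hS : Nat.card S = 2 ^ i) {x y : G} (hx : x ∈ S) (hy : y ∈ S) (hx0 : x ≠ 0) (hy0 : y ≠ 0)
    (hxy : x ≠ y) : 4 ≤ Nat.card S := by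
  have hsub : ({0, x, y} : Set G) ⊆ S := by
    rintro z (rfl | rfl | rfl)
    exacts [S.zero_mem, hx, hy]
  have h3 : ({0, x, y} : Set G).ncard = 3 :=
    Set.ncard_eq_three.2 ⟨0, x, y, hx0.symm, hy0.symm, hxy, rfl⟩
  have h : 3 ≤ Nat.card S := h3 ▸ Set.ncard_le_ncard hsub (Set.toFinite _)
  rw [hS] at h ⊢
  rcases i with _ | _ | i
  · norm_num at h
  · norm_num at h
  · exact Nat.pow_le_pow_right (n := 2) (by norm_num) (by omega : 2 ≤ i + 1 + 1)

/-- The 2-groups whose doubles do not form a cyclic group. -/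
theorem cyclicallyHarmonious_of_noncyclic_doubles {G : Type*} [AddCommGroup G] [Finite G] {n : ℕ}
    (hG : Nat.card G = 2 ^ n) (hcyc : ¬ IsAddCyclic (twoMultiples G))
    (ih : ∀ K : AddSubgroup G, Nat.card (G ⧸ K) < Nat.card G → RichTwoTorsion (G ⧸ K) →
      CyclicallyHarmonious (G ⧸ K)) : CyclicallyHarmonious G := by
  obtain ⟨u, v, hu, hv, hu0, hv0, huv⟩ : ∃ u v : G, 2 • (2 • u) = 0 ∧ 2 • (2 • v) = 0 ∧
      2 • u ≠ 0 ∧ 2 • v ≠ 0 ∧ 2 • u ≠ 2 • v := by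
    obtain ⟨i, -, hi⟩ := (Nat.dvd_prime_pow Nat.prime_two).1
      (show Nat.card (twoMultiples G) ∣ 2 ^ n from hG ▸ AddSubgroup.card_addSubgroup_dvd_card _)
    by_contra! hcon
    refine hcyc (isAddCyclic_of_involution_unique i _ hi ?_)
    rintro ⟨_, u, rfl⟩ ⟨_, v, rfl⟩ hx hy hx0 hy0
    refine Subtype.ext (hcon u v (congrArg Subtype.val hx) (congrArg Subtype.val hy) ?_ ?_)
    · exact fun h => hx0 (Subtype.ext h)
    · exact fun h => hy0 (Subtype.ext h)
  have h4 : ∀ x : G, 2 • (2 • x) = 0 → 4 • x = 0 := fun x hx => by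
    rw [← hx, ← mul_nsmul']
  have hT : 4 ≤ Nat.card (twoTorsion G) := by
    obtain ⟨i, hi⟩ := exists_card_twoTorsion G
    exact four_le_card hi hu hv hu0 hv0 huv
  have hM : 4 ≤ Nat.card (twoMultiples G) := by
    obtain ⟨i, -, hi⟩ := (Nat.dvd_prime_pow Nat.prime_two).1
      (show Nat.card (twoMultiples G) ∣ 2 ^ n from hG ▸ AddSubgroup.card_addSubgroup_dvd_card _)
    exact four_le_card hi ⟨u, rfl⟩ ⟨v, rfl⟩ hu0 hv0 huv
  have hG8 : Nat.card G ≠ 8 := by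
    rw [← card_twoTorsion_mul_card_twoMultiples]
    nlinarith
  -- An involution `w` outside the span of `2 u` and `2 v` gives the subgroup generated by `w` and
  -- `u`, which misses the double `2 v`.
  by_cases hw : ∃ w : G, 2 • w = 0 ∧ w ≠ 0 ∧ w ≠ 2 • u ∧ w ≠ 2 • v ∧ w ≠ 2 • u + 2 • v
  · obtain ⟨w, hw, hw0, hwu, hwv, hwuv⟩ := hw
    have hc := isCoding_addTwoFour hw (h4 u hu) hw0 hu0 hwu
    refine cyclicallyHarmonious_of_quotient_addTwoFour hc hG hG8 (Or.inl ⟨v, ?_⟩) ih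
    rintro ⟨a, ha, h⟩
    change (a / 4) • w + (a % 4) • u = 2 • v at h
    have h2 := two_nsmul_of_mem_addTwoFour hw hu a
    rw [h, hv] at h2
    interval_cases a <;> simp at h h2
    · exact hv0 h.symm
    · exact hu0 h2.symm
    · exact huv h
    · exact hu0 h2.symm
    · exact hwv h
    · exact hu0 h2.symm
    · refine hwuv ?_
      rw [← h, add_left_comm, ← two_nsmul, hu, add_zero]
    · exact hu0 h2.symm
  · push Not at hw
    have hc1 := isCoding_addTwoFour hv (h4 u hu) hv0 hu0 huv.symm
    have hc2 := isCoding_addTwoFour hu (h4 v hv) hu0 hv0 huv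
    by_cases h1 : ∃ x : G, 2 • x ∉ codedSubgroup isTable_addTwoFour hc1
    · exact cyclicallyHarmonious_of_quotient_addTwoFour hc1 hG hG8 (Or.inl h1) ih
    by_cases h2 : ∃ x : G, 2 • x ∉ codedSubgroup isTable_addTwoFour hc2
    · exact cyclicallyHarmonious_of_quotient_addTwoFour hc2 hG hG8 (Or.inl h2) ih
    push Not at h1 h2
    -- All doubles lie in both candidate subgroups, so `4 x` belongs to `{0, 2 u}` and to `{0, 2 v}`
    -- and must vanish. Hence kernel and image of doubling have order at most four, the group has
    -- order at most `16`, and the quotient order at most two.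
    have hle : twoMultiples G ≤ twoTorsion G := by
      rintro _ ⟨x, rfl⟩
      obtain ⟨a, -, ha⟩ := h1 x
      obtain ⟨b, -, hb⟩ := h2 x
      change 2 • (2 • x) = 0
      have ha' := two_nsmul_of_mem_addTwoFour hv hu a
      have hb' := two_nsmul_of_mem_addTwoFour hu hv b
      rw [show (a / 4) • (2 • v) + (a % 4) • u = 2 • x from ha] at ha'
      rw [show (b / 4) • (2 • u) + (b % 4) • v = 2 • x from hb] at hb'
      rcases Nat.mod_two_eq_zero_or_one a with h | h <;>
        rcases Nat.mod_two_eq_zero_or_one b with h' | h' <;>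
        simp only [h, h', zero_smul, one_smul] at ha' hb'
      · exact ha'
      · exact ha'
      · exact hb'
      · exact absurd (ha'.symm.trans hb') huv
    have hT4 : Nat.card (twoTorsion G) ≤ 4 := by
      classical
      have hsub : ((twoTorsion G : AddSubgroup G) : Set G) ⊆
          ↑({0, 2 • u, 2 • v, 2 • u + 2 • v} : Finset G) := by
        intro x hx
        simp only [Finset.coe_insert, Finset.coe_singleton, Set.mem_insert_iff,
          Set.mem_singleton_iff]
        by_contra! hcon
        exact hcon.2.2.2 (hw x hx hcon.1 hcon.2.1 hcon.2.2.1)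
      have hle4 := Set.ncard_le_ncard hsub (Finset.finite_toSet _)
      rw [Set.ncard_coe_finset] at hle4
      exact hle4.trans Finset.card_le_four
    have hM4 := AddSubgroup.card_le_of_le hle
    refine cyclicallyHarmonious_of_quotient_addTwoFour hc1 hG hG8 (Or.inr ?_) ih
    have hcard := (codedSubgroup isTable_addTwoFour hc1).card_eq_card_quotient_mul_card_addSubgroup
    rw [card_codedSubgroup, ← card_twoTorsion_mul_card_twoMultiples] at hcard
    nlinarith

/-! ### The induction for even order -/

/-- An abelian group of even order with two involutions in which some double does not vanish is
cyclically harmonious. -/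
theorem cyclicallyHarmonious_of_richTwoTorsion (n : ℕ) : ∀ (G : Type*) [AddCommGroup G] [Finite G],
    Nat.card G = n → RichTwoTorsion G → CyclicallyHarmonious G := by
  induction n using Nat.strong_induction_on with
  | _ n ih =>
  intro G _ _ hG hrich
  have ihK : ∀ K : AddSubgroup G, Nat.card (G ⧸ K) < Nat.card G → RichTwoTorsion (G ⧸ K) →
      CyclicallyHarmonious (G ⧸ K) := fun K hK h => ih _ (hG ▸ hK) (G ⧸ K) rfl h
  have hT := hrich.two_lt_card
  obtain ⟨x, hx⟩ := hrich.2
  rcases lt_or_ge 32 (Nat.card (twoTorsion G)) with hT' | hT'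
  · exact cyclicallyHarmonious_of_large_twoTorsion hT' hx ihK
  by_cases hp : ∃ p, p.Prime ∧ p ∣ Nat.card G ∧ p ≠ 2
  · obtain ⟨p, hp, hdvd, hp2⟩ := hp
    have := Fact.mk hp
    obtain ⟨g, hg⟩ := exists_prime_addOrderOf_dvd_card' p hdvd
    have hodd : Odd (addOrderOf g) := hg ▸ hp.odd_of_ne_two hp2
    have hg0 : g ≠ 0 := by
      rintro rfl
      simp only [addOrderOf_zero] at hg
      exact hp.one_lt.ne hg
    by_cases hy : ∃ y : G, 2 • y ∉ AddSubgroup.zmultiples g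
    · obtain ⟨y, hy⟩ := hy
      exact cyclicallyHarmonious_of_odd_element g hodd (ihK _
        (card_quotient_lt (AddSubgroup.mem_zmultiples g) hg0) (hrich.quotient_of_odd hodd hy))
    -- Now all doubles are multiples of `g`. As `2 g` has the same prime order, the doubles form the
    -- cyclic group generated by `2 g`.
    · push Not at hy
      have hg2 : 2 • g ≠ 0 := fun h => hg0 (mem_zmultiples_of_two_nsmul hodd h
        (AddSubgroup.mem_zmultiples g))
      have hord : addOrderOf (2 • g) = p := by
        rw [addOrderOf_nsmul' g two_ne_zero, hg, Nat.Coprime.gcd_eq_one, Nat.div_one]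
        exact (Nat.coprime_primes hp Nat.prime_two).2 hp2
      refine cyclicallyHarmonious_of_cyclic_doubles_odd (t := g) (fun y => ?_)
        (hord ▸ hg ▸ hodd) (hord ▸ hp.one_lt) hT hT'
      have hle : AddSubgroup.zmultiples (2 • g) = AddSubgroup.zmultiples g := by
        refine AddSubgroup.eq_of_le_of_card_ge ?_ ?_
        · exact AddSubgroup.zmultiples_le_of_mem (hy g)
        · rw [Nat.card_zmultiples, Nat.card_zmultiples, hord, hg]
      have hmem := hy y
      rw [← hle] at hmem
      obtain ⟨z, hz⟩ := hmem
      exact ⟨z, hz.symm⟩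
  · push Not at hp
    have hG2 : Nat.card G = 2 ^ _ := Nat.eq_prime_pow_of_unique_prime_dvd Nat.card_pos.ne'
      fun {p} h1 h2 => hp p h1 h2
    by_cases hcyc : IsAddCyclic (twoMultiples G)
    · obtain ⟨⟨_, t, rfl⟩, ht⟩ := hcyc.exists_generator
      obtain ⟨i, -, hi⟩ := (Nat.dvd_prime_pow Nat.prime_two).1 (hG2 ▸ addOrderOf_dvd_natCard (2 • t))
      have hgen : ∀ y : G, ∃ z : ℤ, 2 • y = z • (2 • t) := fun y => by
        obtain ⟨z, hz⟩ := ht ⟨2 • y, y, rfl⟩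
        exact ⟨z, (congrArg Subtype.val hz).symm⟩
      rcases i with _ | i
      · rw [pow_zero, AddMonoid.addOrderOf_eq_one_iff] at hi
        obtain ⟨z, hz⟩ := hgen x
        rw [hi, smul_zero] at hz
        exact absurd hz hx
      · exact cyclicallyHarmonious_of_cyclic_doubles_even hgen hi hT hT'
    · exact cyclicallyHarmonious_of_noncyclic_doubles hG2 hcyc ihK

/-- A group of order `n` that satisfies the cycle condition is cyclically harmonious. -/
theorem CycleCondition.cyclicallyHarmonious {H : Type*} [AddCommGroup H] {n : ℕ} (hn : 0 < n)
    (h : CycleCondition n H) : CyclicallyHarmonious H := by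
  obtain ⟨hcard, h⟩ := h
  have : Finite H := Nat.finite_of_card_ne_zero (by omega)
  rcases h with hodd | ⟨-, s, hs, L, ⟨φ⟩⟩
  · exact cyclicallyHarmonious_of_odd_card n H hcard hodd
  · have hs2 : ((s + s : ℕ) : ZMod (2 * s)) = 0 := by
      rw [← two_mul]
      exact ZMod.natCast_self _
    have hs0 : ((s : ℕ) : ZMod (2 * s)) ≠ 0 := by
      rw [Ne, ZMod.natCast_eq_zero_iff]
      exact fun h => absurd (Nat.le_of_dvd (by omega) h) (by omega)
    have h20 : ((2 : ℕ) : ZMod (2 * s)) ≠ 0 := by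
      rw [Ne, ZMod.natCast_eq_zero_iff]
      exact fun h => absurd (Nat.le_of_dvd (by omega) h) (by omega)
    set ψ : ZMod 2 × ZMod (2 * s) →+ H := L.subtype.comp φ.symm.toAddMonoidHom
    have hψ : Function.Injective ψ := Subtype.val_injective.comp φ.symm.injective
    have hψ0 : ∀ y, y ≠ 0 → ψ y ≠ 0 := fun y hy => (map_ne_zero_iff ψ hψ).2 hy
    -- The involutions are `(1, 0)` and `(0, s)`; the generator `(0, 1)` has a nonzero double
    -- because `s ≥ 2`.
    refine cyclicallyHarmonious_of_richTwoTorsion n H hcard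
      ⟨⟨ψ (1, 0), ψ (0, (s : ℕ)), ?_, ?_, hψ0 _ ?_, hψ0 _ ?_, hψ.ne ?_⟩, ψ (0, 1), ?_⟩
    · rw [← map_nsmul]
      refine (congrArg ψ ?_).trans (map_zero ψ)
      ext
      · rfl
      · simp
    · rw [← map_nsmul]
      refine (congrArg ψ ?_).trans (map_zero ψ)
      ext
      · simp
      · simpa [two_mul] using hs2
    · simp
    · simpa using hs0
    · simp
    · rw [← map_nsmul]
      refine hψ0 _ ?_
      simpa using h20

/-! ### The open web and its labelling -/

theorem generalizedOpenWeb_adj_none {m n : ℕ} {y : Fin m × Fin n} :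
    (generalizedOpenWeb m n).Adj none (some y) ↔ (y.1 : ℕ) = 0 := by
  refine (SimpleGraph.deleteEdges_adj (G := generalizedClosedWeb m n)).trans
    ⟨fun h => h.1, fun h => ⟨h, ?_⟩⟩
  rintro ⟨i, a, b, -, -, h⟩
  simp at h

theorem generalizedOpenWeb_adj_some {m n : ℕ} {x y : Fin m × Fin n} :
    (generalizedOpenWeb m n).Adj (some x) (some y) ↔
      ((x.1 : ℕ) + 1 = y.1 ∨ (y.1 : ℕ) + 1 = x.1) ∧ x.2 = y.2 ∨
        (SimpleGraph.cycleGraph n).Adj x.2 y.2 ∧ x.1 = y.1 ∧ (x.1 : ℕ) + 1 ≠ m := by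
  have h : (generalizedPrism m n).Adj x y ↔ ((x.1 : ℕ) + 1 = y.1 ∨ (y.1 : ℕ) + 1 = x.1) ∧
      x.2 = y.2 ∨ (SimpleGraph.cycleGraph n).Adj x.2 y.2 ∧ x.1 = y.1 := by
    rw [generalizedPrism, SimpleGraph.boxProd_adj, SimpleGraph.pathGraph_adj]
  refine (SimpleGraph.deleteEdges_adj (G := generalizedClosedWeb m n)).trans ?_
  change (generalizedPrism m n).Adj x y ∧ _ ↔ _
  rw [h]
  obtain ⟨x1, x2⟩ := x
  obtain ⟨y1, y2⟩ := y
  dsimp only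
  constructor
  · rintro ⟨h1 | ⟨h1, rfl⟩, h2⟩
    · exact Or.inl h1
    · exact Or.inr ⟨h1, rfl, fun h3 => h2 ⟨x1, x2, y2, h3, h1, rfl⟩⟩
  · rintro (⟨h1, rfl⟩ | ⟨h1, rfl, h2⟩)
    · refine ⟨Or.inl ⟨h1, rfl⟩, ?_⟩
      rintro ⟨i, a, b, -, -, h3⟩
      simp only [Sym2.eq_iff, Option.some.injEq, Prod.mk.injEq] at h3
      rcases h3 with ⟨⟨rfl, -⟩, rfl, -⟩ | ⟨⟨rfl, -⟩, rfl, -⟩ <;> omega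
    · refine ⟨Or.inr ⟨h1, rfl⟩, ?_⟩
      rintro ⟨i, a, b, h3, -, h4⟩
      simp only [Sym2.eq_iff, Option.some.injEq, Prod.mk.injEq] at h4
      rcases h4 with ⟨⟨rfl, -⟩, -⟩ | ⟨⟨rfl, -⟩, -⟩ <;> exact h2 h3

/-- The edges of the generalized open web: the edges of the cycles, those of the paths, and the
edges at the added vertex. -/
def openWebEdge (l k : ℕ) : (Fin l × Fin (k + 3)) ⊕ (Fin l × Fin (k + 3)) ⊕ Fin (k + 3) →
    Sym2 (Option (Fin (l + 1) × Fin (k + 3)))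
  | .inl (i, j) => s(some (i.castSucc, j), some (i.castSucc, j + 1))
  | .inr (.inl (i, j)) => s(some (i.castSucc, j), some (i.succ, j))
  | .inr (.inr j) => s(none, some (0, j))

theorem openWebEdge_mem (l k : ℕ) (x) :
    openWebEdge l k x ∈ (generalizedOpenWeb (l + 1) (k + 3)).edgeSet := by
  rcases x with ⟨i, j⟩ | ⟨i, j⟩ | j
  · refine generalizedOpenWeb_adj_some.2 (Or.inr ⟨?_, rfl, ?_⟩)
    · rw [SimpleGraph.cycleGraph_adj]
      exact Or.inr (add_sub_cancel_left _ _)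
    · have := i.2
      simp
      omega
  · exact generalizedOpenWeb_adj_some.2 (Or.inl ⟨Or.inl (by simp), rfl⟩)
  · exact generalizedOpenWeb_adj_none.2 rfl

theorem exists_openWebEdge {l k : ℕ} {e} (he : e ∈ (generalizedOpenWeb (l + 1) (k + 3)).edgeSet) :
    ∃ x, openWebEdge l k x = e := by
  have path : ∀ (a b : Fin (l + 1)) (j : Fin (k + 3)), (a : ℕ) + 1 = b →
      ∃ x, openWebEdge l k x = s(some (a, j), some (b, j)) := by
    intro a b j h
    refine ⟨.inr (.inl (⟨a, by omega⟩, j)), ?_⟩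
    rw [openWebEdge]
    congr
    exact Fin.ext h
  have cycle : ∀ (a : Fin (l + 1)) (j j' : Fin (k + 3)), (a : ℕ) + 1 ≠ l + 1 → j' - j = 1 →
      ∃ x, openWebEdge l k x = s(some (a, j), some (a, j')) := by
    intro a j j' h hj
    refine ⟨.inl (⟨a, by omega⟩, j), ?_⟩
    rw [openWebEdge, ← hj, add_sub_cancel]
    rfl
  induction e using Sym2.ind with
  | _ x y =>
  rw [SimpleGraph.mem_edgeSet] at he
  rcases x with _ | ⟨x1, x2⟩ <;> rcases y with _ | ⟨y1, y2⟩
  · exact absurd he (SimpleGraph.irrefl _)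
  · refine ⟨.inr (.inr y2), ?_⟩
    rw [openWebEdge, show (0 : Fin (l + 1)) = y1 from
      Fin.ext (generalizedOpenWeb_adj_none.1 he).symm]
  · refine ⟨.inr (.inr x2), ?_⟩
    rw [openWebEdge, show (0 : Fin (l + 1)) = x1 from
      Fin.ext (generalizedOpenWeb_adj_none.1 he.symm).symm, Sym2.eq_swap]
  · rcases generalizedOpenWeb_adj_some.1 he with ⟨h1 | h1, h2⟩ | ⟨h1, h2, h3⟩ <;> dsimp only at *
    · subst h2
      exact path _ _ _ h1
    · subst h2
      rw [Sym2.eq_swap]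
      exact path _ _ _ h1
    · subst h2
      rcases SimpleGraph.cycleGraph_adj.1 h1 with h | h
      · rw [Sym2.eq_swap]
        exact cycle _ _ _ h3 h
      · exact cycle _ _ _ h3 h

/-- The labelling of the generalized open web given by a listing `h` of a subgroup of `Γ` and an
element `t` that generates the quotient. -/
def openWebLabel {Γ : Type*} [AddCommGroup Γ] (l k : ℕ) (t : Γ) (h : ℕ → Γ) :
    Option (Fin (l + 1) × Fin (k + 3)) → Γ
  | none => (2 * l) • t
  | some (i, j) => (i : ℕ) • t + h ((i + j) % (k + 3))

/-- The multiples `0, …, 2l` of `t` represent the cosets of `H`. Cycle edges occupy the even ones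
below `2l`, path edges the odd ones, spokes the last one, so a collision forces the same family and
level, where the listing decides. -/
theorem isHarmoniousLabeling_openWebLabel {Γ : Type*} [AddCommGroup Γ] {l k : ℕ} (hl : 0 < l)
    (hΓ : Nat.card Γ = (2 * l + 1) * (k + 3)) {H : AddSubgroup Γ} {t : Γ}
    (ht : addOrderOf (t : Γ ⧸ H) = 2 * l + 1) {h : ℕ → Γ} (hH : ∀ i, h i ∈ H)
    (hinj : ∀ i < k + 3, ∀ j < k + 3, h i = h j → i = j)
    (hsum : ∀ i < k + 3, ∀ j < k + 3,
      h i + h ((i + 1) % (k + 3)) = h j + h ((j + 1) % (k + 3)) → i = j) :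
    IsHarmoniousLabeling (generalizedOpenWeb (l + 1) (k + 3)) (openWebLabel l k t h) := by
  have : Finite Γ := Nat.finite_of_card_ne_zero (by rw [hΓ]; positivity)
  have key : ∀ a < 2 * l + 1, ∀ b < 2 * l + 1, ∀ x ∈ H, ∀ y ∈ H, a • t + x = b • t + y →
      a = b ∧ x = y := by
    intro a ha b hb x hx y hy hxy
    have h1 : a • (t : Γ ⧸ H) = b • (t : Γ ⧸ H) := by
      have h2 : ((a • t + x : Γ) : Γ ⧸ H) = (b • t + y : Γ) := congrArg _ hxy
      rwa [QuotientAddGroup.mk_add, QuotientAddGroup.mk_add, QuotientAddGroup.mk_nsmul,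
        QuotientAddGroup.mk_nsmul, (QuotientAddGroup.eq_zero_iff x).2 hx,
        (QuotientAddGroup.eq_zero_iff y).2 hy, add_zero, add_zero] at h2
    have h2 := nsmul_eq_nsmul_iff_modEq.1 h1
    rw [ht] at h2
    obtain rfl := Nat.ModEq.eq_of_lt_of_lt h2 ha hb
    exact ⟨rfl, add_left_cancel hxy⟩
  have shift : ∀ (i : ℕ) (j j' : Fin (k + 3)), (i + j) % (k + 3) = (i + j') % (k + 3) →
      j = j' := by
    intro i j j' h
    have h1 : (j : ℕ) ≡ j' [MOD k + 3] := Nat.ModEq.add_left_cancel' i h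
    exact Fin.ext (Nat.ModEq.eq_of_lt_of_lt h1 j.2 j'.2)
  have lt : ∀ a : ℕ, a % (k + 3) < k + 3 := fun a => Nat.mod_lt _ (by omega)
  constructor
  · rintro (_ | ⟨i, j⟩) (_ | ⟨i', j'⟩) hxy
    · rfl
    -- The added vertex lies over `2l`, the others over `0, …, l`; these differ because `l > 0`.
    · have := (key _ (by omega) _ (by omega) 0 H.zero_mem _ (hH _)
        ((add_zero _).trans hxy)).1
      omega
    · have := (key _ (by omega) _ (by omega) _ (hH _) 0 H.zero_mem
        (hxy.trans (add_zero _).symm)).1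
      omega
    · obtain ⟨h1, h2⟩ := key _ (by omega) _ (by omega) _ (hH _) _ (hH _) hxy
      obtain rfl := Fin.ext h1
      rw [shift _ _ _ (hinj _ (lt _) _ (lt _) h2)]
  · set Φ : (Fin l × Fin (k + 3)) ⊕ (Fin l × Fin (k + 3)) ⊕ Fin (k + 3) → Γ :=
      fun x => edgeLabel (openWebLabel l k t h) (openWebEdge l k x) with hΦ
    have Φ1 : ∀ (i : Fin l) (j : Fin (k + 3)), Φ (.inl (i, j)) = (2 * (i : ℕ)) • t +
        (h ((i + j) % (k + 3)) + h (((i + j) % (k + 3) + 1) % (k + 3))) := by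
      intro i j
      have h1 : ((i : ℕ) + ((j + 1 : Fin (k + 3)) : ℕ)) % (k + 3) =
          ((i + j) % (k + 3) + 1) % (k + 3) := by
        rw [Fin.val_add, Fin.val_one, Nat.add_mod_mod, Nat.mod_add_mod, add_assoc]
      change (i : ℕ) • t + h ((i + j) % (k + 3)) +
        ((i : ℕ) • t + h ((i + ((j + 1 : Fin (k + 3)) : ℕ)) % (k + 3))) = _
      rw [h1, two_mul, add_nsmul]
      abel
    have Φ2 : ∀ (i : Fin l) (j : Fin (k + 3)), Φ (.inr (.inl (i, j))) = (2 * (i : ℕ) + 1) • t +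
        (h ((i + j) % (k + 3)) + h (((i + j) % (k + 3) + 1) % (k + 3))) := by
      intro i j
      -- Going down one level advances the index of the listing by one, just as going round the
      -- cycle does.
      have h1 : ((i : ℕ) + 1 + (j : ℕ)) % (k + 3) = ((i + j) % (k + 3) + 1) % (k + 3) := by
        rw [Nat.mod_add_mod, add_right_comm]
      change (i : ℕ) • t + h ((i + j) % (k + 3)) +
        (((i : ℕ) + 1) • t + h (((i : ℕ) + 1 + j) % (k + 3))) = _
      rw [h1, two_mul, add_nsmul, add_nsmul, add_nsmul]
      abel
    have Φ3 : ∀ j : Fin (k + 3), Φ (.inr (.inr j)) = (2 * l) • t + h j := by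
      intro j
      change (2 * l) • t + (0 • t + h ((0 + j) % (k + 3))) = _
      rw [zero_smul, zero_add, zero_add, Nat.mod_eq_of_lt j.2]
    have hΦinj : Function.Injective Φ := by
      rintro (⟨i, j⟩ | ⟨i, j⟩ | j) (⟨i', j'⟩ | ⟨i', j'⟩ | j') hxy <;>
        simp only [Φ1, Φ2, Φ3] at hxy <;>
        obtain ⟨h1, h2⟩ := key _ (by omega) _ (by omega) _
          (by first | exact H.add_mem (hH _) (hH _) | exact hH _) _
          (by first | exact H.add_mem (hH _) (hH _) | exact hH _) hxy
      · obtain rfl : i = i' := Fin.ext (by omega)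
        rw [shift _ _ _ (hsum _ (lt _) _ (lt _) h2)]
      · omega
      · omega
      · omega
      · obtain rfl : i = i' := Fin.ext (by omega)
        rw [shift _ _ _ (hsum _ (lt _) _ (lt _) h2)]
      · omega
      · omega
      · omega
      · rw [Fin.ext (hinj _ j.2 _ j'.2 h2)]
    -- There are `2l n + n = (2l + 1) n` edges, exactly the order of `Γ`, so injectivity suffices.
    have hΦbij : Function.Bijective Φ := hΦinj.bijective_of_nat_card_le (by
      rw [hΓ]
      simp
      ring_nf
      rfl)
    constructor
    · rintro ⟨e, he⟩ ⟨e', he'⟩ hee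
      obtain ⟨x, rfl⟩ := exists_openWebEdge he
      obtain ⟨x', rfl⟩ := exists_openWebEdge he'
      exact Subtype.ext (congrArg (openWebEdge l k) (hΦinj hee))
    · intro y
      obtain ⟨x, hx⟩ := hΦbij.2 y
      exact ⟨⟨_, openWebEdge_mem l k x⟩, hx⟩

end GammaHarmonious

theorem mainTheorem5 (n m : ℕ) (hn : 3 ≤ n) (hm : 2 ≤ m) (Γ : Type*) [AddCommGroup Γ]
    (hΓ : Nat.card Γ = (2 * m - 1) * n) (H : AddSubgroup Γ)
    (hH : GammaHarmonious.CycleCondition n H) (hcyc : IsAddCyclic (Γ ⧸ H)) :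
    GammaHarmonious.IsHarmonious (GammaHarmonious.generalizedOpenWeb m n) Γ := by
  obtain ⟨l, rfl⟩ : ∃ l, m = l + 1 := ⟨m - 1, by omega⟩
  obtain ⟨k, rfl⟩ : ∃ k, n = k + 3 := ⟨n - 3, by omega⟩
  rw [show 2 * (l + 1) - 1 = 2 * l + 1 by omega] at hΓ
  have hQ : Nat.card (Γ ⧸ H) = 2 * l + 1 := by
    have h := H.card_eq_card_quotient_mul_card_addSubgroup
    rw [hH.1, hΓ] at h
    exact (Nat.eq_of_mul_eq_mul_right (by omega) h).symm
  obtain ⟨s, hs⟩ := hcyc.exists_generator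
  obtain ⟨t, rfl⟩ := QuotientAddGroup.mk_surjective s
  obtain ⟨h, hinj, hsum⟩ := hH.cyclicallyHarmonious (by omega)
  rw [hH.1] at hinj hsum
  exact ⟨_, GammaHarmonious.isHarmoniousLabeling_openWebLabel (h := fun i => (h i : Γ))
    (by omega) hΓ ((addOrderOf_eq_card_of_forall_mem_zmultiples hs).trans hQ) (fun i => (h i).2)
    (fun i hi j hj hij => hinj i hi j hj (Subtype.ext hij))
    (fun i hi j hj hij => hsum i hi j hj (Subtype.ext hij))⟩
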